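/- **Setting.** Let $\mathcal X$ be a finite data set, $\mathcal Y$ a finite label set, $\ell:\mathcal Z\times\mathcal Y\to[0,1]$ a loss, and $D$ a probability distribution on $\mathcal X\times\mathcal Y$. The data set is partitioned into clusters $\mathcal B_1,\dots,\mathcal B_k$ of positive probability; $\mathcal B_i$ has $N_i$ samples $x_{i,1},\dots,x_{i,N_i}$, and $D_i$ is $D$ conditioned on $x\in\mathcal B_i$. Let $\mathcal H_i$ be a non-empty finite class of functions $\mathcal X\to\mathcal Z$, let $\mathcal H$ be the class of functions that coincide on every $\mathcal B_i$ with some member of $\mathcal H_i$, let $R(h)=\mathbb E_{(x,y)\sim D}\,\ell(h(x),y)$, and let $h^*$ minimize $R$ over $\mathcal H$. **Algorithm.** Let $\delta>0$, $T=k\tau$, $\tau\ge 2$. In every cluster, importance-weighted active learning runs for $\tau$ rounds on independent draws $(x_t,y_t)\sim D_i$, beginning with $V_1=\mathcal H_i$. In round $t$ the label of $x_t$ is queried ($q_t=1$, otherwise $q_t=0$) with probability $p_t=\max_{f,g\in V_t}\max_y|\ell(f(x_t),y)-\ell(g(x_t),y)|$. With $L_t(h)=\frac1t\sum_{s\le t}\frac{q_s}{p_s}\ell(h(x_s),y_s)$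 (terms with $q_s=0$ are $0$), the new version space is $V_{t+1}=\{h\in V_t: L_t(h)\le \min_{g\in V_t}L_t(g)+2\Delta_t\}$, where $$\Delta_t=\frac1t\Big[\sqrt{\textstyle\sum_{s\le t}p_s}+6\sqrt{\log\tfrac{2(3+\tau)\tau^2}{\delta}}\Big]\sqrt{\log\tfrac{16\tau^2|\mathcal H_i|^2\log\tau}{\delta}} .$$ The output of the cluster is any minimizer of $L_\tau$ over $V_{\tau+1}$. The final hypothesis $h_\tau$ uses on each $\mathcal B_i$ the output of that cluster. The draws of different clusters may depend on each other. Write $p_{i,t}$ for the query probability of round $t$ in cluster $i$, and let the label complexity $N$ be the total number of queried labels in all clusters. **Constants.** Let $\rho_i(f,g)=\mathbb E_{x\sim D_i}\max_y|\ell(f(x),y)-\ell(g(x),y)|$ and $$\theta_i=\sup_{r>0}\frac1r\,\mathbb E_{x\sim D_i}\ \sup_{h\in\mathcal H_i,\ \rho_i(h,h^*)\le r}\ \max_y|\ell(h(x),y)-\ell(h^*(x),y)|,\qquad K_i=\sup_{z,z'}\frac{\max_y|\ell(z,y)-\ell(z',y)|}{\min_y|\ell(z,y)-\ell(z',y)|}\in[0,\infty],$$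 where $z,z'$ range over the predictions $h(x)$, $h\in\mathcal H_i$, $x\in\mathcal B_i$ (and $0/0=0$, $a/0=\infty$ for $a>0$). Let $p_j^{(i)}$ be the probability that a draw from $D_i$ is the sample $x_{i,j}$, and $R_j^{*,(i)}$ the expected loss of $h^*$ at that sample (under the conditional law of its label). **Theorem.** There is a function $C:\mathbb R^2\to\mathbb R$ such that in every such setting: 1. with probability at least $1-\delta$, $$R(h_\tau)-R(h^*)\le k\max_{1\le i\le k}\Big\{\frac2\tau\Big[\sqrt{\textstyle\sum_{t=1}^\tau p_{i,t}}+6\sqrt{\log\tfrac{2(3+\tau)\tau^2}{\delta}}\Big]\sqrt{\log\tfrac{16\tau^2|\mathcal H_i|^2\log\tau}{\delta}}\Big\};$$ 2. if all $K_i$ are finite (otherwise the bound is infinite), then with probability at least $1-2\delta$, $$N\le 8k\max_{1\le i\le k}K_i\Big\{\sum_{j=1}^{N_i}\theta_iR_j^{*,(i)}\tau p_j^{(i)}+C_i\sum_{j=1}^{N_i}\sqrt{R_j^{*,(i)}\tau p_j^{(i)}\log\tfrac{\tau|\mathcal H_i|N_i}{\delta}}+C_iN_i\log^3\tfrac{\tau|\mathcal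 H_i|N_i}{\delta}\Big\},\qquad C_i=C(\theta_i,K_i).$$ -/

import Mathlib

open MeasureTheory ProbabilityTheory
open scoped ENNReal

namespace LowResource

noncomputable section

section Notions

variable {X Y Z : Type*} {k : ℕ}

/-- The loss disagreement of the predictions `z, z'`: `max_y |ℓ(z,y) - ℓ(z',y)|`. -/
def lossDis (ℓ : Z → Y → ℝ) (z z' : Z) : ℝ := ⨆ y : Y, |ℓ z y - ℓ z' y|

/-- The expected loss `E_{(x,y) ∼ P} ℓ(h(x),y)`. -/
def risk [MeasurableSpace X] [MeasurableSpace Y]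
    (ℓ : Z → Y → ℝ) (P : Measure (X × Y)) (h : X → Z) : ℝ :=
  ∫ a, ℓ (h a.1) a.2 ∂P

/-- The law of a labelled sample given that the sample lies in cluster `i`. -/
def clusterLaw [MeasurableSpace X] [MeasurableSpace Y]
    (D : Measure (X × Y)) (c : X → Fin k) (i : Fin k) : Measure (X × Y) :=
  D[|{a | c a.1 = i}]

/-- The number `N_i` of samples in cluster `i`. -/
def clusterSize [Fintype X] (c : X → Fin k) (i : Fin k) : ℕ :=
  (Finset.univ.filter fun x => c x = i).card

/-- The hypothesis that uses `g i` on cluster `i`. -/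
def glue (c : X → Fin k) (g : Fin k → X → Z) : X → Z := fun x => g (c x) x

/-- The hypothesis class: the functions that use some member of `H i` on every cluster `i`. -/
def hypClass (c : X → Fin k) (H : Fin k → Finset (X → Z)) : Set (X → Z) :=
  {h | ∃ g : Fin k → X → Z, (∀ i, g i ∈ H i) ∧ h = glue c g}

/-- The distance `ρ(f,g) = E_{x ∼ P} max_y |ℓ(f(x),y) - ℓ(g(x),y)|`. -/
def hypDist [MeasurableSpace X] [MeasurableSpace Y]
    (ℓ : Z → Y → ℝ) (P : Measure (X × Y)) (f g : X → Z) : ℝ :=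
  ∫ a, lossDis ℓ (f a.1) (g a.1) ∂P

/-- The ball `B(h*,r)` of the class `H` in the distance `ρ`. -/
def hypBall [MeasurableSpace X] [MeasurableSpace Y]
    (ℓ : Z → Y → ℝ) (P : Measure (X × Y)) (H : Finset (X → Z)) (hstar : X → Z) (r : ℝ) :
    Set (X → Z) :=
  {h | h ∈ H ∧ hypDist ℓ P h hstar ≤ r}

/-- The error disagreement coefficient
`θ = sup_{r > 0} (1/r) E_{x ∼ P} sup_{h ∈ B(h*,r)} max_y |ℓ(h(x),y) - ℓ(h*(x),y)|`. -/
def disCoeff [MeasurableSpace X] [MeasurableSpace Y]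
    (ℓ : Z → Y → ℝ) (P : Measure (X × Y)) (H : Finset (X → Z)) (hstar : X → Z) : ℝ :=
  ⨆ r : Set.Ioi (0 : ℝ),
    (∫ a, (⨆ h : hypBall ℓ P H hstar r, lossDis ℓ (h.1 a.1) (hstar a.1)) ∂P) / (r : ℝ)

/-- The slope asymmetry of the loss over the predictions that hypotheses of `H` make on `B`:
the supremum of `max_y |ℓ(z,y) - ℓ(z',y)| / min_y |ℓ(z,y) - ℓ(z',y)|`
(in `[0,∞]`, with `0/0 = 0` and `a/0 = ∞` for `a > 0`). -/
def slopeAsym (ℓ : Z → Y → ℝ) (H : Finset (X → Z)) (B : Set X) : ℝ≥0∞ :=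
  ⨆ (h ∈ H) (h' ∈ H) (x ∈ B) (x' ∈ B),
    ENNReal.ofReal (⨆ y : Y, |ℓ (h x) y - ℓ (h' x') y|) /
      ENNReal.ofReal (⨅ y : Y, |ℓ (h x) y - ℓ (h' x') y|)

/-- The probability that a draw from `P` is the sample `x`. -/
def sampleProb [MeasurableSpace X] [MeasurableSpace Y] (P : Measure (X × Y)) (x : X) : ℝ :=
  P.real {a | a.1 = x}

/-- The risk of `h` at the sample `x`: the expected loss of `h` given that `x` is drawn. -/
def sampleRisk [MeasurableSpace X] [MeasurableSpace Y]
    (ℓ : Z → Y → ℝ) (P : Measure (X × Y)) (h : X → Z) (x : X) : ℝ :=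
  risk ℓ (P[|{a | a.1 = x}]) h

end Notions

section IWAL

variable {X Y Z : Type*}

/-- What importance-weighted active learning remembers after some number of rounds. -/
structure IWALState (X Z : Type*) where
  /-- the version space -/
  space : Finset (X → Z)
  /-- the sum of the query probabilities so far -/
  sumProb : ℝ
  /-- the importance-weighted cumulative loss `∑ (q_s / p_s) ℓ(h(x_s),y_s)` -/
  cumLoss : (X → Z) → ℝ
  /-- the number of labels that were queried -/
  queries : ℕ

/-- The query probability `p = max_{f,g ∈ V} max_y |ℓ(f(x),y) - ℓ(g(x),y)|`. -/
def queryProb (ℓ : Z → Y → ℝ) (V : Finset (X → Z)) (x : X) : ℝ :=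
  ⨆ q : V × V, lossDis ℓ (q.1.1 x) (q.2.1 x)

/-- The allowed loss disagreement `Δ_t` after `t` rounds out of `τ`, for a class of `m`
hypotheses, when the query probabilities so far have the sum `S`. -/
def slack (δ : ℝ) (τ m t : ℕ) (S : ℝ) : ℝ :=
  1 / t * (√S + 6 * √(Real.log (2 * (3 + τ) * τ ^ 2 / δ))) *
    √(Real.log (16 * τ ^ 2 * m ^ 2 * Real.log τ / δ))

open Classical in
/-- Round `t` on the sample `x` with label `y`: the label is queried when the coin `u`, uniform
on `[0,1]`, falls below the query probability; then the version space keeps the hypotheses whose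
importance-weighted empirical risk is within `2 Δ_t` of the least one. -/
def iwalStep (ℓ : Z → Y → ℝ) (δ : ℝ) (τ m t : ℕ) (s : IWALState X Z) (z : (X × Y) × ℝ) :
    IWALState X Z :=
  let p := queryProb ℓ s.space z.1.1
  let q : ℕ := if z.2 < p then 1 else 0
  let W : (X → Z) → ℝ := fun h => s.cumLoss h + q / p * ℓ (h z.1.1) z.1.2
  { space := s.space.filter fun h =>
      ∀ g ∈ s.space, W h / t ≤ W g / t + 2 * slack δ τ m t (s.sumProb + p)
    sumProb := s.sumProb + p
    cumLoss := W
    queries := s.queries + q }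

/-- The state after the first `t` rounds on the stream `z`, started from the finite class `H`;
`τ` is the planned number of rounds and `δ` the confidence parameter. -/
def iwal (ℓ : Z → Y → ℝ) (δ : ℝ) (τ : ℕ) (H : Finset (X → Z)) (z : ℕ → (X × Y) × ℝ) :
    ℕ → IWALState X Z
  | 0 => ⟨H, 0, fun _ => 0, 0⟩
  | t + 1 => iwalStep ℓ δ τ H.card (t + 1) (iwal ℓ δ τ H z t) (z t)

/-- The possible outputs: the members of the version space with the least importance-weighted
empirical risk. -/
def IWALState.outputs (s : IWALState X Z) : Set (X → Z) :=
  {h | h ∈ s.space ∧ ∀ g ∈ s.space, s.cumLoss h ≤ s.cumLoss g}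

end IWAL

end

end LowResource

/-! Fix one cluster. Given the drawn sample and label, the coin makes `q/p * a`, with `|a| ≤ p`, an
unbiased estimate of a loss difference `a`, with second moment at most `p`. Hence its exponential at
scale `b`, divided by `exp (c b² p)`, has coin mean at most `1 + b a`. The products over the rounds
are supermartingales, and Markov's inequality bounds the gap between true and importance-weighted
advantage by `c b S + x / b`, where `S` is the observed sum of the query probabilities and not its
mean (`IsSampling.tail_deviation`). The best `b` depends on the random `S`, so a union over dyadic
scales is taken; about `log τ` of them suffice since `S ≤ τ`. For small `S` a bound that is uniform
over the class replaces it (`IsSampling.tail_queries_add_mean`). Together all deviations are at most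
`2 t Δ_t` outside an event of probability `δ / τ` (`IsSampling.measure_compl_reliable_le`). Then the
optimum is never discarded, the survivors of round `t` have excess risk at most `4 Δ_t`, and the
output at most `2 Δ_τ`.

For the label count, excess risk `d` places a version space in a ball of radius `K (2 R + d)` around
the optimum, so its mean query probability is at most `2 θ K (2 R + d)` (`meanProb_le_of_excess`).
Summed over the rounds, this bounds the total mean by a term linear in `R` and one containing `√S`.
As `S` and the number of queries are controlled by the total mean, the inequality is self-bounding
(`queries_le_of_selfBounding`).

The clusters may be dependent. For the risk, a union bound costs `k δ / τ ≤ δ` if `k ≤ τ`, and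
otherwise the claimed bound is at least `1`. For the labels, the bound of each cluster leaves one
label to spare and a bad cluster asks for at most `τ` labels, so the total fails only if at least `k
/ τ` clusters are bad; Markov's inequality for the number of bad clusters gives `2 δ`. -/

namespace LowResource

/-! ### Exponential supermartingales along finite-valued recursions -/

section Recursion

variable {Ω W S : Type*} [MeasurableSpace W]

lemma measurable_indicator_one {m : MeasurableSpace Ω} {A : Set Ω} (hA : MeasurableSet A) :
    Measurable (A.indicator (1 : Ω → ℝ≥0∞)) :=
  measurable_one.indicator hA

/-- The σ-algebra generated by the draws before time `t`. -/
@[reducible] def past (z : ℕ → Ω → W) (t : ℕ) : MeasurableSpace Ω :=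
  ⨆ i ∈ Set.Iio t, MeasurableSpace.comap (z i) inferInstance

lemma past_le [MeasurableSpace Ω] {z : ℕ → Ω → W} (hz : ∀ t, Measurable (z t)) (t : ℕ) :
    past z t ≤ ‹MeasurableSpace Ω› :=
  iSup₂_le fun i _ => (hz i).comap_le

lemma past_mono (z : ℕ → Ω → W) {s t : ℕ} (h : s ≤ t) : past z s ≤ past z t :=
  biSup_mono fun _ hi => lt_of_lt_of_le hi h

lemma measurable_past (z : ℕ → Ω → W) {s t : ℕ} (h : s < t) : Measurable[past z t] (z s) := by
  have h1 : MeasurableSpace.comap (z s) inferInstance ≤ past z t :=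
    le_biSup (fun i => MeasurableSpace.comap (z i) inferInstance) (Set.mem_Iio.2 h)
  exact (comap_measurable (z s)).mono h1 le_rfl

lemma indep_past [MeasurableSpace Ω] {μ : Measure Ω} {z : ℕ → Ω → W} (hz : ∀ t, Measurable (z t))
    (hi : iIndepFun z μ) (t : ℕ) :
    Indep (past z t) (MeasurableSpace.comap (z t) inferInstance) μ := by
  have := indep_iSup_of_disjoint (fun i => (hz i).comap_le) hi
    (S := Set.Iio t) (T := {t}) (by simp)
  simpa [past] using this

/-- `st` is the sequence of states of a recursion driven by `z` that takes finitely many values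
in each step. -/
structure IsRecursion (z : ℕ → Ω → W) (st : ℕ → Ω → S) (s₀ : S) (step : ℕ → S → W → S) :
    Prop where
  zero : ∀ ω, st 0 ω = s₀
  succ : ∀ t ω, st (t + 1) ω = step t (st t ω) (z t ω)
  finite : ∀ t s, (Set.range (step t s)).Finite
  measurable : ∀ t s A, MeasurableSet (step t s ⁻¹' A)

namespace IsRecursion

variable {z : ℕ → Ω → W} {st : ℕ → Ω → S} {s₀ : S} {step : ℕ → S → W → S}

lemma finite_range (h : IsRecursion z st s₀ step) (t : ℕ) : (Set.range (st t)).Finite := by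
  induction t with
  | zero => exact (Set.finite_singleton s₀).subset (by rintro _ ⟨ω, rfl⟩; exact h.zero ω)
  | succ t ih =>
    refine (ih.biUnion fun s _ => h.finite t s).subset ?_
    rintro _ ⟨ω, rfl⟩
    rw [h.succ]
    exact Set.mem_biUnion (Set.mem_range_self ω) (Set.mem_range_self _)

lemma measurableSet_preimage (h : IsRecursion z st s₀ step) (t : ℕ) (A : Set S) :
    MeasurableSet[past z t] (st t ⁻¹' A) := by
  induction t generalizing A with
  | zero =>
    have : st 0 ⁻¹' A = {_ω | s₀ ∈ A} := by ext ω; simp [h.zero]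
    rw [this]
    exact @MeasurableSet.const _ (past z 0) _
  | succ t ih =>
    have : st (t + 1) ⁻¹' A =
        ⋃ s ∈ Set.range (st t), (st t ⁻¹' {s}) ∩ (z t ⁻¹' (step t s ⁻¹' A)) := by
      ext ω
      simp only [Set.mem_preimage, h.succ, Set.mem_iUnion, Set.mem_inter_iff,
        Set.mem_singleton_iff, exists_prop]
      exact ⟨fun hA => ⟨_, Set.mem_range_self ω, rfl, hA⟩, by rintro ⟨s, -, rfl, hA⟩; exact hA⟩
    rw [this]
    refine @Set.Finite.measurableSet_biUnion _ _ (past z (t + 1)) _ _ (h.finite_range t)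
      fun s _ => ?_
    exact @MeasurableSet.inter _ (past z (t + 1)) _ _ (past_mono z t.le_succ _ (ih _))
      (measurable_past z t.lt_succ_self (h.measurable t s A))

/-- The product of the weights collected in the first `n` steps. -/
noncomputable def weight (z : ℕ → Ω → W) (st : ℕ → Ω → S) (φ : S → W → ℝ≥0∞) (n : ℕ)
    (ω : Ω) : ℝ≥0∞ :=
  ∏ t ∈ Finset.range n, φ (st t ω) (z t ω)

open Classical in
-- Splitting over the finitely many states replaces the random state by fixed ones, so no σ-algebra
-- on `S` and no joint measurability of `φ` is needed.
lemma apply_eq_sum (h : IsRecursion z st s₀ step) (φ : S → W → ℝ≥0∞) (t : ℕ) (ω : Ω) :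
    φ (st t ω) (z t ω) = ∑ s ∈ (h.finite_range t).toFinset,
      (st t ⁻¹' {s}).indicator 1 ω * φ s (z t ω) := by
  rw [Finset.sum_eq_single (st t ω)]
  · simp
  · intro s _ hs
    rw [Set.indicator_of_notMem (by simpa using hs.symm), zero_mul]
  · intro hs
    exact absurd ((h.finite_range t).mem_toFinset.2 (Set.mem_range_self ω)) hs

lemma measurable_weight (h : IsRecursion z st s₀ step) {φ : S → W → ℝ≥0∞}
    (hφ : ∀ s, Measurable (φ s)) (n : ℕ) : Measurable[past z n] (weight z st φ n) := by
  unfold weight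
  refine Finset.measurable_prod _ fun t ht => ?_
  have ht' := Finset.mem_range.1 ht
  simp_rw [h.apply_eq_sum φ t]
  refine Finset.measurable_sum _ fun s _ => ?_
  refine Measurable.mul ?_ ((hφ s).comp (measurable_past z ht'))
  exact measurable_indicator_one (past_mono z ht'.le _ (h.measurableSet_preimage t _))

/-- The supermartingale property. On each event that fixes the current state, the weight so far
depends on the past only and is independent of the next draw, whose factor has mean at most `1`. -/
lemma lintegral_weight_le_one [MeasurableSpace Ω] {μ : Measure Ω} [IsProbabilityMeasure μ] {ν : Measure W}
    (h : IsRecursion z st s₀ step) (hz : ∀ t, Measurable (z t)) (hi : iIndepFun z μ)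
    (hlaw : ∀ t, μ.map (z t) = ν) {φ : S → W → ℝ≥0∞} (hφ : ∀ s, Measurable (φ s))
    (hφ1 : ∀ s, ∫⁻ w, φ s w ∂ν ≤ 1) (n : ℕ) : ∫⁻ ω, weight z st φ n ω ∂μ ≤ 1 := by
  induction n with
  | zero => simp [weight]
  | succ n ih =>
    set F := (h.finite_range n).toFinset
    have hm := h.measurable_weight hφ n
    have hind : ∀ s, Measurable[past z n] fun ω => weight z st φ n ω *
        (st n ⁻¹' {s}).indicator 1 ω := fun s => hm.mul
      (measurable_indicator_one (h.measurableSet_preimage n _))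
    have e1 : ∀ ω, weight z st φ (n + 1) ω = ∑ s ∈ F,
        (weight z st φ n ω * (st n ⁻¹' {s}).indicator 1 ω) * φ s (z n ω) := by
      intro ω
      rw [weight, Finset.prod_range_succ, h.apply_eq_sum φ n, Finset.mul_sum]
      simp only [weight, mul_assoc, F]
    have e2 : ∀ ω, weight z st φ n ω = ∑ s ∈ F,
        (weight z st φ n ω * (st n ⁻¹' {s}).indicator 1 ω) := by
      intro ω
      have := h.apply_eq_sum (fun _ _ => 1) n ω
      simp only [mul_one] at this
      rw [← Finset.mul_sum, ← this, mul_one]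
    have hp := past_le hz n
    calc ∫⁻ ω, weight z st φ (n + 1) ω ∂μ
        = ∑ s ∈ F, ∫⁻ ω, (weight z st φ n ω * (st n ⁻¹' {s}).indicator 1 ω) *
            φ s (z n ω) ∂μ := by
          simp_rw [e1]
          exact lintegral_finsetSum _ fun s _ =>
            ((hind s).mono hp le_rfl).mul ((hφ s).comp (hz n))
      _ = ∑ s ∈ F, (∫⁻ ω, weight z st φ n ω * (st n ⁻¹' {s}).indicator 1 ω ∂μ) *
            ∫⁻ ω, φ s (z n ω) ∂μ := by
          refine Finset.sum_congr rfl fun s _ => ?_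
          exact lintegral_mul_eq_lintegral_mul_lintegral_of_independent_measurableSpace hp
            (hz n).comap_le (indep_past hz hi n) (hind s)
            ((hφ s).comp (comap_measurable (z n)))
      _ ≤ ∑ s ∈ F, (∫⁻ ω, weight z st φ n ω * (st n ⁻¹' {s}).indicator 1 ω ∂μ) * 1 := by
          refine Finset.sum_le_sum fun s _ => ?_
          gcongr
          rw [← lintegral_map (hφ s) (hz n), hlaw]
          exact hφ1 s
      _ = ∫⁻ ω, weight z st φ n ω ∂μ := by
          simp only [mul_one]
          rw [← lintegral_finsetSum _ fun s _ => (hind s).mono hp le_rfl]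
          simp_rw [← e2]
      _ ≤ 1 := ih

/-- If the logarithmic weights `ψ` have conditional exponential moments at most `1`, then their sum
exceeds `x` with probability at most `exp (-x)`. -/
lemma measure_sum_ge_le [MeasurableSpace Ω] {μ : Measure Ω} [IsProbabilityMeasure μ] {ν : Measure W}
    (h : IsRecursion z st s₀ step) (hz : ∀ t, Measurable (z t)) (hi : iIndepFun z μ)
    (hlaw : ∀ t, μ.map (z t) = ν) {ψ : S → W → ℝ} (hψ : ∀ s, Measurable (ψ s))
    (hψ1 : ∀ s, ∫⁻ w, ENNReal.ofReal (Real.exp (ψ s w)) ∂ν ≤ 1) (n : ℕ) (x : ℝ) :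
    μ {ω | x ≤ ∑ t ∈ Finset.range n, ψ (st t ω) (z t ω)} ≤ ENNReal.ofReal (Real.exp (-x)) := by
  have hφ : ∀ s, Measurable fun w => ENNReal.ofReal (Real.exp (ψ s w)) :=
    fun s => (Real.measurable_exp.comp (hψ s)).ennreal_ofReal
  have h1 := h.lintegral_weight_le_one hz hi hlaw hφ hψ1 n
  have h2 := mul_meas_ge_le_lintegral ((h.measurable_weight hφ n).mono (past_le hz n) le_rfl)
    (ENNReal.ofReal (Real.exp x)) (μ := μ)
  have h3 : {ω | x ≤ ∑ t ∈ Finset.range n, ψ (st t ω) (z t ω)} ⊆ {ω | ENNReal.ofReal (Real.exp x) ≤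
      weight z st (fun s w => ENNReal.ofReal (Real.exp (ψ s w))) n ω} := by
    intro ω hω
    simp only [weight, Set.mem_ofPred_eq] at hω ⊢
    rw [← ENNReal.ofReal_prod_of_nonneg fun _ _ => (Real.exp_pos _).le, ← Real.exp_sum]
    exact ENNReal.ofReal_le_ofReal (Real.exp_le_exp.2 hω)
  refine (measure_mono h3).trans ?_
  rw [Real.exp_neg, ENNReal.ofReal_inv_of_pos (Real.exp_pos _), ← one_div,
    ENNReal.le_div_iff_mul_le (by simp [Real.exp_pos]) (by simp), mul_comm]
  exact h2.trans h1

end IsRecursion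

end Recursion

/-! ### Numerical exponential inequalities -/

section RealInequalities

lemma exp_sub_one_sub_le {u b : ℝ} (hu : |u| ≤ b) (hb : b ≤ 1) :
    Real.exp u - 1 - u ≤ b ^ 2 * (1 / 2 + b / 6 + 5 * b ^ 2 / 96) := by
  have h0 : 0 ≤ |u| := abs_nonneg u
  have h := Real.exp_bound (hu.trans hb) (n := 4) (by norm_num)
  have h' := (abs_le.1 h).2
  simp only [Finset.sum_range_succ, Finset.sum_range_zero, Nat.factorial] at h'
  norm_num at h'
  have h2 : u ^ 2 = |u| ^ 2 := (sq_abs u).symm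
  have h3 : u ^ 3 ≤ |u| ^ 3 := by rw [← abs_pow]; exact le_abs_self _
  have m2 : |u| ^ 2 ≤ b ^ 2 := by gcongr
  have m3 : |u| ^ 3 ≤ b ^ 3 := by gcongr
  have m4 : |u| ^ 4 ≤ b ^ 4 := by gcongr
  have : (b : ℝ) ^ 2 * (1 / 2 + b / 6 + 5 * b ^ 2 / 96) = b ^ 2 / 2 + b ^ 3 / 6 + b ^ 4 * (5 / 96) := by
    ring
  linarith

/-- `c` is an admissible variance constant at the scale `b`. -/
def VarConst (c b : ℝ) : Prop :=
  0 < b ∧ b ≤ 1 / 2 ∧ b ^ 2 * (1 / 2 + b / 6 + 5 * b ^ 2 / 96) ≤ c * b ^ 2 * (1 - b)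

lemma VarConst.two_fifths : VarConst (24 / 25) (2 / 5) := by
  refine ⟨by norm_num, by norm_num, by norm_num⟩

lemma VarConst.of_le {b : ℝ} (h0 : 0 < b) (h1 : b ≤ 1 / 5) : VarConst (67 / 100) b := by
  refine ⟨h0, by linarith, ?_⟩
  have : 1 / 2 + b / 6 + 5 * b ^ 2 / 96 ≤ 67 / 100 * (1 - b) := by nlinarith
  nlinarith [sq_nonneg b]

/-- The exponential moment of an importance-weighted loss difference `a`. -/
lemma coin_exp_le {c b a p : ℝ} (h : VarConst c b) (hp1 : p ≤ 1) (ha : |a| ≤ p) :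
    (1 - p) + p * Real.exp (b * (1 / p * a)) ≤ (1 + b * a) * Real.exp (c * b ^ 2 * p) := by
  obtain ⟨hb0, hb1, hc⟩ := h
  have hp0 : 0 ≤ p := (abs_nonneg a).trans ha
  set u := b * (1 / p * a) with hu
  have hpu : p * u = b * a := by
    rcases hp0.eq_or_lt with h0 | h0
    · have : a = 0 := by rw [← h0] at ha; simpa using ha
      simp [this, hu]
    · rw [hu]; field_simp
  have hub : |u| ≤ b := by
    rcases hp0.eq_or_lt with h0 | h0
    · simp [hu, ← h0, hb0.le]
    · rw [hu, abs_mul, abs_of_pos hb0, abs_mul, abs_of_pos (by positivity : 0 < 1 / p)]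
      have : 1 / p * |a| ≤ 1 := by
        rw [one_div, inv_mul_le_iff₀ h0]; simpa using ha
      nlinarith
  have h1 := exp_sub_one_sub_le hub (by linarith)
  have h2 : c * b ^ 2 * p + 1 ≤ Real.exp (c * b ^ 2 * p) := Real.add_one_le_exp _
  have h3 : b * a ≥ -b * p := by nlinarith [neg_abs_le a]
  have h4 : 0 ≤ 1 + b * a := by nlinarith
  have hc0 : 0 ≤ c * b ^ 2 := by
    have : 0 ≤ c * b ^ 2 * (1 - b) := le_trans (by positivity) hc
    exact nonneg_of_mul_nonneg_left this (by linarith)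
  -- The coin mean is `1 + b a + p (exp u - 1 - u)`. As `1 - b ≤ 1 + b a`, the factor `1 - b` in
  -- `VarConst` turns the additive remainder into a multiplicative one.
  calc (1 - p) + p * Real.exp u ≤ (1 + b * a) + p * (c * b ^ 2 * (1 - b)) := by
        rw [← hpu]; nlinarith
    _ ≤ (1 + b * a) * (c * b ^ 2 * p + 1) := by
        have : 0 ≤ c * b ^ 2 * p := by positivity
        have : 1 - b ≤ 1 + b * a := by nlinarith
        nlinarith
    _ ≤ _ := by gcongr

lemma exp_mul_le {b p : ℝ} (hp0 : 0 ≤ p) (hp1 : p ≤ 1) :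
    Real.exp (b * p) ≤ 1 + (Real.exp b - 1) * p := by
  have := convexOn_exp.2 (Set.mem_univ 0) (Set.mem_univ b)
    (sub_nonneg.2 hp1) hp0 (sub_add_cancel 1 p)
  simp only [smul_eq_mul, mul_zero, zero_add, Real.exp_zero] at this
  rw [mul_comm b p]
  linarith

lemma exp_two_fifths_le : Real.exp (2 / 5) ≤ 3 / 2 := by
  have := exp_sub_one_sub_le (u := 2 / 5) (b := 2 / 5) (by norm_num [abs_of_pos])
    (by norm_num)
  norm_num at this
  linarith

lemma exp_two_fifths_mul_le {p : ℝ} (hp0 : 0 ≤ p) (hp1 : p ≤ 1) :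
    Real.exp (2 / 5 * p) ≤ 1 + 1 / 2 * p :=
  (exp_mul_le hp0 hp1).trans (by nlinarith [exp_two_fifths_le])

/-- Trading a coin of success probability `p` and its mean for the probability itself. -/
lemma coin_exp_sub_le {p : ℝ} (hp0 : 0 ≤ p) (hp1 : p ≤ 1) :
    ((1 - p) + p * Real.exp (1 / 10)) * Real.exp (-(11 / 50 * p)) ≤ 1 - 1 / 10 * p := by
  -- The penalty `11/50` exceeds the coin's growth `53/500` by `57/500`. Since `exp (-57/500) ≤
  -- 9/10`, convexity in `p` leaves the factor `1 - p/10`.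
  have e1 : Real.exp (1 / 10) ≤ 1 + 53 / 500 := by
    have := exp_sub_one_sub_le (u := 1 / 10) (b := 1 / 10) (by norm_num [abs_of_pos])
      (by norm_num)
    norm_num at this
    linarith
  have e2 : Real.exp (-(57 / 500)) ≤ 9 / 10 := by
    have := exp_sub_one_sub_le (u := -(57 / 500)) (b := 57 / 500)
      (by rw [abs_neg, abs_of_pos]; norm_num) (by norm_num)
    norm_num at this ⊢
    linarith
  have e3 := exp_mul_le (b := -(57 / 500)) hp0 hp1
  have e4 : 1 + 53 / 500 * p ≤ Real.exp (53 / 500 * p) := by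
    linarith [Real.add_one_le_exp (53 / 500 * p)]
  calc ((1 - p) + p * Real.exp (1 / 10)) * Real.exp (-(11 / 50 * p))
      ≤ Real.exp (53 / 500 * p) * Real.exp (-(11 / 50 * p)) := by
        gcongr; nlinarith
    _ = Real.exp (-(57 / 500) * p) := by rw [← Real.exp_add]; congr 1; ring
    _ ≤ 1 - 1 / 10 * p := by nlinarith

end RealInequalities

/-! ### Loss disagreement and query probability -/

section Loss

variable {X Y Z : Type*} {ℓ : Z → Y → ℝ}

lemma lossDis_nonneg (z z' : Z) : 0 ≤ lossDis ℓ z z' := Real.iSup_nonneg fun _ => abs_nonneg _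

lemma abs_sub_le_lossDis [Finite Y] (z z' : Z) (y : Y) : |ℓ z y - ℓ z' y| ≤ lossDis ℓ z z' :=
  le_ciSup (f := fun y => |ℓ z y - ℓ z' y|) (Set.finite_range _).bddAbove y

lemma lossDis_le_one (hℓ : ∀ z y, 0 ≤ ℓ z y ∧ ℓ z y ≤ 1) (z z' : Z) : lossDis ℓ z z' ≤ 1 := by
  refine Real.iSup_le (fun y => ?_) zero_le_one
  rw [abs_le]
  constructor <;> linarith [hℓ z y, hℓ z' y]

lemma lossDis_comm (z z' : Z) : lossDis ℓ z z' = lossDis ℓ z' z := by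
  simp only [lossDis, abs_sub_comm]

lemma lossDis_triangle [Finite Y] (z z' z'' : Z) :
    lossDis ℓ z z'' ≤ lossDis ℓ z z' + lossDis ℓ z' z'' := by
  refine Real.iSup_le (fun y => ?_) (add_nonneg (lossDis_nonneg _ _) (lossDis_nonneg _ _))
  exact (abs_sub_le _ (ℓ z' y) _).trans
    (add_le_add (abs_sub_le_lossDis _ _ _) (abs_sub_le_lossDis _ _ _))

lemma queryProb_nonneg (V : Finset (X → Z)) (x : X) : 0 ≤ queryProb ℓ V x :=
  Real.iSup_nonneg fun _ => lossDis_nonneg _ _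

lemma queryProb_le_one (hℓ : ∀ z y, 0 ≤ ℓ z y ∧ ℓ z y ≤ 1) (V : Finset (X → Z)) (x : X) :
    queryProb ℓ V x ≤ 1 :=
  Real.iSup_le (fun _ => lossDis_le_one hℓ _ _) zero_le_one

lemma lossDis_le_queryProb {V : Finset (X → Z)} {f g : X → Z} (hf : f ∈ V) (hg : g ∈ V) (x : X) :
    lossDis ℓ (f x) (g x) ≤ queryProb ℓ V x :=
  le_ciSup (f := fun q : V × V => lossDis ℓ (q.1.1 x) (q.2.1 x)) (Set.finite_range _).bddAbove
    (⟨f, hf⟩, ⟨g, hg⟩)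

lemma abs_sub_le_queryProb [Finite Y] {V : Finset (X → Z)} {f g : X → Z} (hf : f ∈ V) (hg : g ∈ V)
    (x : X) (y : Y) : |ℓ (f x) y - ℓ (g x) y| ≤ queryProb ℓ V x :=
  (abs_sub_le_lossDis _ _ _).trans (lossDis_le_queryProb hf hg x)

end Loss

/-! ### Integrating out the uniform coin -/

section Coin

variable {A : Type*} [MeasurableSpace A] [Finite A] [MeasurableSingletonClass A]

/-- The joint law of a draw from `P` and an independent uniform coin. -/
noncomputable def coinLaw (P : Measure A) : Measure (A × ℝ) :=
  P.prod (volume.restrict (Set.Icc (0 : ℝ) 1))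

lemma volume_coin_lt {p : ℝ} (hp1 : p ≤ 1) :
    volume.restrict (Set.Icc (0 : ℝ) 1) (Set.Iio p) = ENNReal.ofReal p := by
  rw [Measure.restrict_apply measurableSet_Iio]
  have : Set.Iio p ∩ Set.Icc 0 1 = Set.Ico 0 p := by
    ext u
    simp only [Set.mem_inter_iff, Set.mem_Iio, Set.mem_Icc, Set.mem_Ico]
    constructor
    · rintro ⟨h1, h2, -⟩; exact ⟨h2, h1⟩
    · rintro ⟨h1, h2⟩; exact ⟨h2, h1, by linarith⟩
  rw [this, Real.volume_Ico, sub_zero]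

lemma volume_coin_ge {p : ℝ} (hp0 : 0 ≤ p) :
    volume.restrict (Set.Icc (0 : ℝ) 1) (Set.Iio p)ᶜ = ENNReal.ofReal (1 - p) := by
  rw [Set.compl_Iio, Measure.restrict_apply measurableSet_Ici]
  have : Set.Ici p ∩ Set.Icc 0 1 = Set.Icc p 1 := by
    ext u
    simp only [Set.mem_inter_iff, Set.mem_Ici, Set.mem_Icc]
    constructor
    · rintro ⟨h1, -, h2⟩; exact ⟨h1, h2⟩
    · rintro ⟨h1, h2⟩; exact ⟨h1, by linarith, h2⟩
  rw [this, Real.volume_Icc]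

lemma measurableSet_coin_lt (p : A → ℝ) : MeasurableSet {w : A × ℝ | w.2 < p w.1} :=
  measurableSet_lt measurable_snd ((Measurable.of_discrete (f := p)).comp measurable_fst)

open Classical in
lemma lintegral_coin (P : Measure A) [SFinite P] {p : A → ℝ} (hp0 : ∀ a, 0 ≤ p a)
    (hp1 : ∀ a, p a ≤ 1) (G₁ G₀ : A → ℝ≥0∞) :
    ∫⁻ w, (if w.2 < p w.1 then G₁ w.1 else G₀ w.1) ∂coinLaw P =
      ∫⁻ a, ENNReal.ofReal (p a) * G₁ a + ENNReal.ofReal (1 - p a) * G₀ a ∂P := by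
  have hm : Measurable fun w : A × ℝ => if w.2 < p w.1 then G₁ w.1 else G₀ w.1 :=
    Measurable.ite (measurableSet_coin_lt p)
      ((Measurable.of_discrete (f := G₁)).comp measurable_fst)
      ((Measurable.of_discrete (f := G₀)).comp measurable_fst)
  rw [coinLaw, lintegral_prod _ hm.aemeasurable]
  refine lintegral_congr fun a => ?_
  have e : (fun u : ℝ => if u < p a then G₁ a else G₀ a) =
      fun u => (Set.Iio (p a)).indicator (fun _ => G₁ a) u +
        (Set.Iio (p a))ᶜ.indicator (fun _ => G₀ a) u := by
    funext u
    by_cases hu : u < p a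
    · simp [hu]
    · simp [hu, not_lt.1 hu]
  simp only [e]
  rw [lintegral_add_left (measurable_const.indicator measurableSet_Iio),
    lintegral_indicator_const measurableSet_Iio,
    lintegral_indicator_const measurableSet_Iio.compl, volume_coin_lt (hp1 a),
    volume_coin_ge (hp0 a), mul_comm (G₁ a), mul_comm (G₀ a)]

/-- The coin is averaged for each labelled sample separately, and only the mean of `B` has to be at
most `1`. Exponents may therefore contain penalties in the observed query probability. -/
lemma lintegral_coin_exp_le_one (P : Measure A) [IsProbabilityMeasure P] {p : A → ℝ}
    (hp0 : ∀ a, 0 ≤ p a) (hp1 : ∀ a, p a ≤ 1) (ψ₁ ψ₀ B : A → ℝ)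
    (h : ∀ a, p a * Real.exp (ψ₁ a) + (1 - p a) * Real.exp (ψ₀ a) ≤ B a)
    (hB : ∫ a, B a ∂P ≤ 1) :
    ∫⁻ w, ENNReal.ofReal (Real.exp (if w.2 < p w.1 then ψ₁ w.1 else ψ₀ w.1)) ∂coinLaw P ≤ 1 := by
  have e := lintegral_coin P hp0 hp1 (fun a => ENNReal.ofReal (Real.exp (ψ₁ a)))
    (fun a => ENNReal.ofReal (Real.exp (ψ₀ a)))
  have hB0 : ∀ a, 0 ≤ B a := fun a => le_trans
    (add_nonneg (mul_nonneg (hp0 a) (Real.exp_pos _).le)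
      (mul_nonneg (sub_nonneg.2 (hp1 a)) (Real.exp_pos _).le)) (h a)
  calc _ = ∫⁻ a, ENNReal.ofReal (p a) * ENNReal.ofReal (Real.exp (ψ₁ a)) +
        ENNReal.ofReal (1 - p a) * ENNReal.ofReal (Real.exp (ψ₀ a)) ∂P := by
        rw [← e]
        refine lintegral_congr fun w => ?_
        split_ifs <;> rfl
    _ ≤ ∫⁻ a, ENNReal.ofReal (B a) ∂P := by
        refine lintegral_mono fun a => ?_
        rw [← ENNReal.ofReal_mul (hp0 a), ← ENNReal.ofReal_mul (sub_nonneg.2 (hp1 a)),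
          ← ENNReal.ofReal_add (mul_nonneg (hp0 a) (Real.exp_pos _).le)
            (mul_nonneg (sub_nonneg.2 (hp1 a)) (Real.exp_pos _).le)]
        exact ENNReal.ofReal_le_ofReal (h a)
    _ = ENNReal.ofReal (∫ a, B a ∂P) :=
        (ofReal_integral_eq_lintegral_ofReal Integrable.of_finite (ae_of_all _ hB0)).symm
    _ ≤ 1 := by simpa using ENNReal.ofReal_le_ofReal hB

end Coin

/-! ### The learner as a recursion -/

section Learner

variable {X Y Z Ω : Type*} [Fintype X] [MeasurableSpace X] [MeasurableSingletonClass X]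
  [Fintype Y] [MeasurableSpace Y] [MeasurableSingletonClass Y]

/-- `1` if the label of the draw `w` is queried in the state `s`, and `0` otherwise. -/
noncomputable def coin (ℓ : Z → Y → ℝ) (s : IWALState X Z) (w : (X × Y) × ℝ) : ℕ :=
  if w.2 < queryProb ℓ s.space w.1.1 then 1 else 0

/-- The state before round `t + 1`. -/
noncomputable def learner (ℓ : Z → Y → ℝ) (δ : ℝ) (τ : ℕ) (H : Finset (X → Z))
    (z : ℕ → Ω → (X × Y) × ℝ) (t : ℕ) (ω : Ω) : IWALState X Z :=
  iwal ℓ δ τ H (fun t => z t ω) t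

/-- The query probability of round `t + 1`. -/
noncomputable def roundProb (ℓ : Z → Y → ℝ) (δ : ℝ) (τ : ℕ) (H : Finset (X → Z))
    (z : ℕ → Ω → (X × Y) × ℝ) (t : ℕ) (ω : Ω) : ℝ :=
  queryProb ℓ (learner ℓ δ τ H z t ω).space (z t ω).1.1

/-- The number of queries in round `t + 1`. -/
noncomputable def roundCoin (ℓ : Z → Y → ℝ) (δ : ℝ) (τ : ℕ) (H : Finset (X → Z))
    (z : ℕ → Ω → (X × Y) × ℝ) (t : ℕ) (ω : Ω) : ℕ :=
  coin ℓ (learner ℓ δ τ H z t ω) (z t ω)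

section Deterministic

omit [Fintype X] [MeasurableSpace X] [MeasurableSingletonClass X]
  [Fintype Y] [MeasurableSpace Y] [MeasurableSingletonClass Y]

variable (ℓ : Z → Y → ℝ) (δ : ℝ) (τ : ℕ) (H : Finset (X → Z)) (z : ℕ → Ω → (X × Y) × ℝ)
  (t : ℕ) (ω : Ω)

lemma learner_sumProb :
    (learner ℓ δ τ H z t ω).sumProb = ∑ s ∈ Finset.range t, roundProb ℓ δ τ H z s ω := by
  induction t with
  | zero => simp [learner, iwal]
  | succ t ih => rw [Finset.sum_range_succ, ← ih]; rfl

lemma learner_queries :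
    (learner ℓ δ τ H z t ω).queries = ∑ s ∈ Finset.range t, roundCoin ℓ δ τ H z s ω := by
  induction t with
  | zero => simp [learner, iwal]
  | succ t ih => rw [Finset.sum_range_succ, ← ih]; rfl

lemma learner_cumLoss (h : X → Z) :
    (learner ℓ δ τ H z t ω).cumLoss h = ∑ s ∈ Finset.range t,
      (roundCoin ℓ δ τ H z s ω : ℝ) / roundProb ℓ δ τ H z s ω *
        ℓ (h (z s ω).1.1) (z s ω).1.2 := by
  induction t with
  | zero => simp [learner, iwal]
  | succ t ih => rw [Finset.sum_range_succ, ← ih]; rfl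

lemma mem_learner_space_succ {h : X → Z} : h ∈ (learner ℓ δ τ H z (t + 1) ω).space ↔
    h ∈ (learner ℓ δ τ H z t ω).space ∧ ∀ g ∈ (learner ℓ δ τ H z t ω).space,
      (learner ℓ δ τ H z (t + 1) ω).cumLoss h / ((t + 1 : ℕ) : ℝ) ≤
        (learner ℓ δ τ H z (t + 1) ω).cumLoss g / ((t + 1 : ℕ) : ℝ) +
        2 * slack δ τ H.card (t + 1) (learner ℓ δ τ H z (t + 1) ω).sumProb :=
  Finset.mem_filter

lemma learner_space_anti {s t : ℕ} (hst : s ≤ t) :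
    (learner ℓ δ τ H z t ω).space ⊆ (learner ℓ δ τ H z s ω).space := by
  induction t, hst using Nat.le_induction with
  | base => exact subset_rfl
  | succ t _ ih => exact fun h hh => ih ((mem_learner_space_succ ..).1 hh).1

lemma learner_space_subset : (learner ℓ δ τ H z t ω).space ⊆ H :=
  learner_space_anti ℓ δ τ H z ω t.zero_le

lemma roundCoin_le_one : roundCoin ℓ δ τ H z t ω ≤ 1 := by
  unfold roundCoin coin; split_ifs <;> simp

lemma learner_queries_le : (learner ℓ δ τ H z t ω).queries ≤ t := by
  rw [learner_queries]
  calc _ ≤ ∑ _s ∈ Finset.range t, 1 := Finset.sum_le_sum fun s _ => roundCoin_le_one ..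
    _ = t := by simp

end Deterministic

lemma isRecursion_learner (ℓ : Z → Y → ℝ) (δ : ℝ) (τ : ℕ) (H : Finset (X → Z))
    (z : ℕ → Ω → (X × Y) × ℝ) :
    IsRecursion z (learner ℓ δ τ H z) ⟨H, 0, fun _ => 0, 0⟩
      (fun t s w => iwalStep ℓ δ τ H.card (t + 1) s w) := by
  classical
  let E : IWALState X Z → (X × Y) × ℝ → (X × Y) × Bool :=
    fun s w => (w.1, decide (w.2 < queryProb ℓ s.space w.1.1))
  -- A round depends on its coin only through the outcome. `G` picks a coin value with a given
  -- outcome: `p - 1` lies below `p`, and `p` does not. Hence each state has finitely many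
  -- successors.
  let G : IWALState X Z → (X × Y) × Bool → (X × Y) × ℝ :=
    fun s a => (a.1, queryProb ℓ s.space a.1.1 - if a.2 then 1 else 0)
  have hG : ∀ t s w, iwalStep ℓ δ τ H.card t s w = iwalStep ℓ δ τ H.card t s (G s (E s w)) := by
    intro t s w
    by_cases h : w.2 < queryProb ℓ s.space w.1.1 <;> simp [iwalStep, E, G, h]
  have hE : ∀ s, Measurable (E s) := by
    intro s
    refine measurable_fst.prodMk (measurable_to_bool ?_)
    have : (fun w : (X × Y) × ℝ => decide (w.2 < queryProb ℓ s.space w.1.1)) ⁻¹' {true} =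
        {w | w.2 < queryProb ℓ s.space w.1.1} := by ext w; simp
    rw [this]
    exact measurableSet_coin_lt fun a : X × Y => queryProb ℓ s.space a.1
  refine ⟨fun _ => rfl, fun _ _ => rfl, fun t s => ?_, fun t s A => ?_⟩
  · refine (Set.finite_range fun a => iwalStep ℓ δ τ H.card (t + 1) s (G s a)).subset ?_
    rintro _ ⟨w, rfl⟩
    exact ⟨E s w, (hG _ _ _).symm⟩
  · have : (fun w => iwalStep ℓ δ τ H.card (t + 1) s w) ⁻¹' A =
        E s ⁻¹' {a | iwalStep ℓ δ τ H.card (t + 1) s (G s a) ∈ A} := by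
      ext w
      simp only [Set.mem_preimage, Set.mem_ofPred_eq]
      rw [hG]
    rw [this]
    exact hE s (Set.toFinite _).measurableSet

variable [MeasurableSpace Ω]

/-- The draws `z` are independent, with common law `P` and independent uniform coins. -/
structure IsSampling (P : Measure (X × Y)) (μ : Measure Ω) (z : ℕ → Ω → (X × Y) × ℝ) : Prop where
  measurable : ∀ t, Measurable (z t)
  indep : iIndepFun z μ
  law : ∀ t, μ.map (z t) = coinLaw P

lemma IsSampling.tail {P : Measure (X × Y)} [IsProbabilityMeasure P] {μ : Measure Ω}
    [IsProbabilityMeasure μ] {z : ℕ → Ω → (X × Y) × ℝ} (hz : IsSampling P μ z)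
    {ℓ : Z → Y → ℝ} (hℓ : ∀ z y, 0 ≤ ℓ z y ∧ ℓ z y ≤ 1) (δ : ℝ) (τ : ℕ) (H : Finset (X → Z))
    (ψ₁ ψ₀ B : IWALState X Z → X × Y → ℝ)
    (h : ∀ s a, queryProb ℓ s.space a.1 * Real.exp (ψ₁ s a) +
      (1 - queryProb ℓ s.space a.1) * Real.exp (ψ₀ s a) ≤ B s a)
    (hB : ∀ s, ∫ a, B s a ∂P ≤ 1) (n : ℕ) (x : ℝ) :
    μ {ω | x ≤ ∑ t ∈ Finset.range n,
      if (z t ω).2 < queryProb ℓ (learner ℓ δ τ H z t ω).space (z t ω).1.1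
        then ψ₁ (learner ℓ δ τ H z t ω) (z t ω).1 else ψ₀ (learner ℓ δ τ H z t ω) (z t ω).1} ≤
      ENNReal.ofReal (Real.exp (-x)) := by
  refine (isRecursion_learner ℓ δ τ H z).measure_sum_ge_le hz.measurable hz.indep hz.law
    (ψ := fun s w => if w.2 < queryProb ℓ s.space w.1.1 then ψ₁ s w.1 else ψ₀ s w.1)
    (fun s => ?_) (fun s => ?_) n x
  · exact Measurable.ite (measurableSet_coin_lt fun a : X × Y => queryProb ℓ s.space a.1)
      ((Measurable.of_discrete (f := ψ₁ s)).comp measurable_fst)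
      ((Measurable.of_discrete (f := ψ₀ s)).comp measurable_fst)
  · exact lintegral_coin_exp_le_one P (fun a => queryProb_nonneg s.space a.1)
      (fun a => queryProb_le_one hℓ s.space a.1) (ψ₁ s) (ψ₀ s) (B s) (h s) (hB s)

end Learner

/-! ### Tail bounds for losses, queries and query probabilities -/

section Tails

variable {X Y Z Ω : Type*} [Fintype X] [MeasurableSpace X] [MeasurableSingletonClass X]
  [Fintype Y] [MeasurableSpace Y] [MeasurableSingletonClass Y] [MeasurableSpace Ω]

/-- The expected query probability for the version space `V`. -/
noncomputable def meanProb (ℓ : Z → Y → ℝ) (P : Measure (X × Y)) (V : Finset (X → Z)) : ℝ :=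
  ∫ a, queryProb ℓ V a.1 ∂P

lemma risk_sub (ℓ : Z → Y → ℝ) (P : Measure (X × Y)) [IsProbabilityMeasure P] (f g : X → Z) :
    ∫ a, (ℓ (f a.1) a.2 - ℓ (g a.1) a.2) ∂P = risk ℓ P f - risk ℓ P g :=
  integral_sub Integrable.of_finite Integrable.of_finite

lemma risk_sub_le_meanProb {ℓ : Z → Y → ℝ} {P : Measure (X × Y)} [IsProbabilityMeasure P]
    {V : Finset (X → Z)} {f g : X → Z} (hf : f ∈ V) (hg : g ∈ V) :
    risk ℓ P f - risk ℓ P g ≤ meanProb ℓ P V := by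
  rw [← risk_sub]
  exact integral_mono Integrable.of_finite Integrable.of_finite
    fun a => (le_abs_self _).trans (abs_sub_le_queryProb hf hg _ _)

variable {P : Measure (X × Y)} [IsProbabilityMeasure P] {μ : Measure Ω} [IsProbabilityMeasure μ]
  {z : ℕ → Ω → (X × Y) × ℝ} {ℓ : Z → Y → ℝ}

open Classical in
-- With `d` the risk difference and `α` the loss difference, the penalty `c b² p` cancels the
-- variance factor of `coin_exp_le` and leaves `exp (b d) (1 + b α)`, whose mean `exp (b d) (1 - b
-- d)` is at most `1`. The weight is switched off in states that have lost `hs` or `g`, because `|α|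
-- ≤ p` fails to be guaranteed there.
lemma IsSampling.tail_deviation (hz : IsSampling P μ z)
    (hℓ : ∀ z y, 0 ≤ ℓ z y ∧ ℓ z y ≤ 1) (δ : ℝ) (τ : ℕ) (H : Finset (X → Z)) {c b : ℝ}
    (hcb : VarConst c b) (hs g : X → Z) (n : ℕ) (x : ℝ) :
    μ {ω | hs ∈ (learner ℓ δ τ H z n ω).space ∧ g ∈ (learner ℓ δ τ H z n ω).space ∧
      c * b * (learner ℓ δ τ H z (n + 1) ω).sumProb + x / b ≤
        (learner ℓ δ τ H z (n + 1) ω).cumLoss hs - (learner ℓ δ τ H z (n + 1) ω).cumLoss g +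
          (n + 1) * (risk ℓ P g - risk ℓ P hs)} ≤ ENNReal.ofReal (Real.exp (-x)) := by
  obtain ⟨d, hd⟩ : ∃ d, d = risk ℓ P g - risk ℓ P hs := ⟨_, rfl⟩
  have hb := hcb.1
  refine (measure_mono ?_).trans (hz.tail hℓ δ τ H
    (fun s a => if hs ∈ s.space ∧ g ∈ s.space then
      b * (1 / queryProb ℓ s.space a.1 * (ℓ (hs a.1) a.2 - ℓ (g a.1) a.2) + d) -
        c * b ^ 2 * queryProb ℓ s.space a.1 else 0)
    (fun s a => if hs ∈ s.space ∧ g ∈ s.space then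
      b * d - c * b ^ 2 * queryProb ℓ s.space a.1 else 0)
    (fun s a => if hs ∈ s.space ∧ g ∈ s.space then
      Real.exp (b * d) * (1 + b * (ℓ (hs a.1) a.2 - ℓ (g a.1) a.2)) else 1)
    (fun s a => ?_) (fun s => ?_) (n + 1) x)
  · rintro ω ⟨h1, h2, h3⟩
    rw [learner_sumProb, learner_cumLoss, learner_cumLoss, ← hd] at h3
    have e : ∀ t ∈ Finset.range (n + 1),
        (if (z t ω).2 < queryProb ℓ (learner ℓ δ τ H z t ω).space (z t ω).1.1 then
          (if hs ∈ (learner ℓ δ τ H z t ω).space ∧ g ∈ (learner ℓ δ τ H z t ω).space then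
            b * (1 / queryProb ℓ (learner ℓ δ τ H z t ω).space (z t ω).1.1 *
              (ℓ (hs (z t ω).1.1) (z t ω).1.2 - ℓ (g (z t ω).1.1) (z t ω).1.2) + d) -
            c * b ^ 2 * queryProb ℓ (learner ℓ δ τ H z t ω).space (z t ω).1.1 else 0)
        else (if hs ∈ (learner ℓ δ τ H z t ω).space ∧ g ∈ (learner ℓ δ τ H z t ω).space then
            b * d - c * b ^ 2 * queryProb ℓ (learner ℓ δ τ H z t ω).space (z t ω).1.1
            else 0)) =
        b * ((roundCoin ℓ δ τ H z t ω : ℝ) / roundProb ℓ δ τ H z t ω *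
            ℓ (hs (z t ω).1.1) (z t ω).1.2 -
          (roundCoin ℓ δ τ H z t ω : ℝ) / roundProb ℓ δ τ H z t ω *
            ℓ (g (z t ω).1.1) (z t ω).1.2 + d) - c * b ^ 2 * roundProb ℓ δ τ H z t ω := by
      intro t ht
      have ht' : t ≤ n := Nat.lt_succ_iff.1 (Finset.mem_range.1 ht)
      -- Version spaces decrease, so membership after `n` rounds keeps the weight switched on in all
      -- rounds that are summed.
      have m1 := learner_space_anti ℓ δ τ H z ω ht' h1
      have m2 := learner_space_anti ℓ δ τ H z ω ht' h2
      simp only [m1, m2, and_self, if_true]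
      by_cases hc : (z t ω).2 < queryProb ℓ (learner ℓ δ τ H z t ω).space (z t ω).1.1
      · simp only [hc, if_true, roundCoin, roundProb, coin]
        push_cast; ring
      · simp only [hc, if_false, roundCoin, roundProb, coin]
        push_cast; ring
    simp only [Set.mem_ofPred_eq]
    rw [Finset.sum_congr rfl e, Finset.sum_sub_distrib, ← Finset.mul_sum, ← Finset.mul_sum,
      Finset.sum_add_distrib, Finset.sum_sub_distrib, Finset.sum_const, Finset.card_range,
      nsmul_eq_mul]
    have := mul_le_mul_of_nonneg_left h3 hb.le
    rw [mul_add, mul_div_cancel₀ _ hb.ne'] at this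
    push_cast
    linarith
  · by_cases hV : hs ∈ s.space ∧ g ∈ s.space
    · simp only [if_pos hV]
      have hp1 := queryProb_le_one hℓ s.space a.1
      have key := coin_exp_le hcb hp1 (abs_sub_le_queryProb hV.1 hV.2 a.1 a.2)
      set p := queryProb ℓ s.space a.1
      set α := ℓ (hs a.1) a.2 - ℓ (g a.1) a.2
      have e1 : Real.exp (b * (1 / p * α + d) - c * b ^ 2 * p) =
          Real.exp (b * d) * Real.exp (b * (1 / p * α)) * Real.exp (-(c * b ^ 2 * p)) := by
        rw [← Real.exp_add, ← Real.exp_add]; ring_nf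
      have e2 : Real.exp (b * d - c * b ^ 2 * p) =
          Real.exp (b * d) * Real.exp (-(c * b ^ 2 * p)) := by
        rw [← Real.exp_add]; ring_nf
      rw [e1, e2]
      calc _ = Real.exp (b * d) * (((1 - p) + p * Real.exp (b * (1 / p * α))) *
            Real.exp (-(c * b ^ 2 * p))) := by ring
        _ ≤ Real.exp (b * d) * (((1 + b * α) * Real.exp (c * b ^ 2 * p)) *
            Real.exp (-(c * b ^ 2 * p))) := by gcongr
        _ = _ := by
            rw [mul_assoc (1 + b * α), ← Real.exp_add, add_neg_cancel, Real.exp_zero, mul_one]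
    · simp [if_neg hV]
  · by_cases hV : hs ∈ s.space ∧ g ∈ s.space
    · simp only [if_pos hV]
      rw [integral_const_mul, integral_add (integrable_const _) Integrable.of_finite,
        integral_const_mul, risk_sub]
      have h1 : 1 + -(b * d) ≤ Real.exp (-(b * d)) := by
        linarith [Real.add_one_le_exp (-(b * d))]
      calc _ = Real.exp (b * d) * (1 + -(b * d)) := by rw [hd]; simp; ring
        _ ≤ Real.exp (b * d) * Real.exp (-(b * d)) := by gcongr
        _ = 1 := by rw [← Real.exp_add, add_neg_cancel, Real.exp_zero]
    · simp [if_neg hV]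

lemma exp_mul_one_add_le (e : ℝ) : Real.exp e * (1 + -e) ≤ 1 := by
  have h1 : 1 + -e ≤ Real.exp (-e) := by linarith [Real.add_one_le_exp (-e)]
  calc _ ≤ Real.exp e * Real.exp (-e) := by gcongr
    _ = 1 := by rw [← Real.exp_add, add_neg_cancel, Real.exp_zero]

/-- Used when the sum of the query probabilities is small. It involves no hypothesis, so no union
over the class is paid for. The exponent has rate `1/10`, whence `10 x` and `11/5 = 10 * 11/50`. -/
lemma IsSampling.tail_queries_add_mean (hz : IsSampling P μ z)
    (hℓ : ∀ z y, 0 ≤ ℓ z y ∧ ℓ z y ≤ 1) (δ : ℝ) (τ : ℕ) (H : Finset (X → Z)) (n : ℕ) (x : ℝ) :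
    μ {ω | 11 / 5 * (learner ℓ δ τ H z n ω).sumProb + 10 * x ≤
      (learner ℓ δ τ H z n ω).queries +
        ∑ t ∈ Finset.range n, meanProb ℓ P (learner ℓ δ τ H z t ω).space} ≤
      ENNReal.ofReal (Real.exp (-x)) := by
  refine (measure_mono ?_).trans (hz.tail hℓ δ τ H
    (fun s a => 1 / 10 * (1 + meanProb ℓ P s.space) - 11 / 50 * queryProb ℓ s.space a.1)
    (fun s a => 1 / 10 * meanProb ℓ P s.space - 11 / 50 * queryProb ℓ s.space a.1)
    (fun s a => Real.exp (1 / 10 * meanProb ℓ P s.space) *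
      (1 + -(1 / 10) * queryProb ℓ s.space a.1))
    (fun s a => ?_) (fun s => ?_) n x)
  · intro ω hω
    simp only [Set.mem_ofPred_eq] at hω ⊢
    rw [learner_sumProb, learner_queries] at hω
    have e : ∀ t ∈ Finset.range n,
        (if (z t ω).2 < queryProb ℓ (learner ℓ δ τ H z t ω).space (z t ω).1.1 then
          1 / 10 * (1 + meanProb ℓ P (learner ℓ δ τ H z t ω).space) -
            11 / 50 * queryProb ℓ (learner ℓ δ τ H z t ω).space (z t ω).1.1
        else 1 / 10 * meanProb ℓ P (learner ℓ δ τ H z t ω).space -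
            11 / 50 * queryProb ℓ (learner ℓ δ τ H z t ω).space (z t ω).1.1) =
        1 / 10 * ((roundCoin ℓ δ τ H z t ω : ℝ) +
          meanProb ℓ P (learner ℓ δ τ H z t ω).space) - 11 / 50 * roundProb ℓ δ τ H z t ω := by
      intro t _
      by_cases hc : (z t ω).2 < queryProb ℓ (learner ℓ δ τ H z t ω).space (z t ω).1.1
      · simp only [hc, if_true, roundCoin, roundProb, coin]
        push_cast; ring
      · simp only [hc, if_false, roundCoin, roundProb, coin]
        push_cast; ring
    rw [Finset.sum_congr rfl e, Finset.sum_sub_distrib, ← Finset.mul_sum, ← Finset.mul_sum,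
      Finset.sum_add_distrib]
    push_cast at hω
    linarith
  · have key := coin_exp_sub_le (queryProb_nonneg (ℓ := ℓ) s.space a.1)
      (queryProb_le_one hℓ s.space a.1)
    set p := queryProb ℓ s.space a.1
    set e := meanProb ℓ P s.space
    have e1 : Real.exp (1 / 10 * (1 + e) - 11 / 50 * p) =
        Real.exp (1 / 10 * e) * (Real.exp (1 / 10) * Real.exp (-(11 / 50 * p))) := by
      rw [← Real.exp_add, ← Real.exp_add]; ring_nf
    have e2 : Real.exp (1 / 10 * e - 11 / 50 * p) =
        Real.exp (1 / 10 * e) * Real.exp (-(11 / 50 * p)) := by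
      rw [← Real.exp_add]; ring_nf
    rw [e1, e2]
    calc _ = Real.exp (1 / 10 * e) *
          (((1 - p) + p * Real.exp (1 / 10)) * Real.exp (-(11 / 50 * p))) := by ring
      _ ≤ _ := by gcongr; linarith
  · rw [integral_const_mul, integral_add (integrable_const _) Integrable.of_finite,
      integral_const_mul]
    have := exp_mul_one_add_le (1 / 10 * meanProb ℓ P s.space)
    simpa [meanProb] using this

/-- Rate `2/5` with `exp (2/5) - 1 ≤ 1/2`: the factor `5/4` is `(1/2) / (2/5)`, and `5/2` is the
inverse rate. The next bound uses the same constants. -/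
lemma IsSampling.tail_queries (hz : IsSampling P μ z)
    (hℓ : ∀ z y, 0 ≤ ℓ z y ∧ ℓ z y ≤ 1) (δ : ℝ) (τ : ℕ) (H : Finset (X → Z)) (n : ℕ) (x : ℝ) :
    μ {ω | 5 / 4 * ∑ t ∈ Finset.range n, meanProb ℓ P (learner ℓ δ τ H z t ω).space +
      5 / 2 * x ≤ (learner ℓ δ τ H z n ω).queries} ≤ ENNReal.ofReal (Real.exp (-x)) := by
  refine (measure_mono ?_).trans (hz.tail hℓ δ τ H
    (fun s a => 2 / 5 - 1 / 2 * meanProb ℓ P s.space)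
    (fun s a => - (1 / 2 * meanProb ℓ P s.space))
    (fun s a => Real.exp (-(1 / 2 * meanProb ℓ P s.space)) *
      (1 + 1 / 2 * queryProb ℓ s.space a.1))
    (fun s a => ?_) (fun s => ?_) n x)
  · intro ω hω
    simp only [Set.mem_ofPred_eq] at hω ⊢
    rw [learner_queries] at hω
    have e : ∀ t ∈ Finset.range n,
        (if (z t ω).2 < queryProb ℓ (learner ℓ δ τ H z t ω).space (z t ω).1.1 then
          2 / 5 - 1 / 2 * meanProb ℓ P (learner ℓ δ τ H z t ω).space
        else -(1 / 2 * meanProb ℓ P (learner ℓ δ τ H z t ω).space)) =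
        2 / 5 * (roundCoin ℓ δ τ H z t ω : ℝ) -
          1 / 2 * meanProb ℓ P (learner ℓ δ τ H z t ω).space := by
      intro t _
      by_cases hc : (z t ω).2 < queryProb ℓ (learner ℓ δ τ H z t ω).space (z t ω).1.1
      · simp only [hc, if_true, roundCoin, coin]
        push_cast; ring
      · simp only [hc, if_false, roundCoin, coin]
        push_cast; ring
    rw [Finset.sum_congr rfl e, Finset.sum_sub_distrib, ← Finset.mul_sum, ← Finset.mul_sum]
    push_cast at hω
    linarith
  · have hp0 := queryProb_nonneg (ℓ := ℓ) s.space a.1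
    have key := exp_two_fifths_le
    rw [sub_eq_add_neg, Real.exp_add]
    set p := queryProb ℓ s.space a.1
    set E := Real.exp (-(1 / 2 * meanProb ℓ P s.space))
    have hE : 0 < E := Real.exp_pos _
    calc _ = E * (1 + p * (Real.exp (2 / 5) - 1)) := by ring
      _ ≤ _ := mul_le_mul_of_nonneg_left (by nlinarith) hE.le
  · rw [integral_const_mul, integral_add (integrable_const _) Integrable.of_finite,
      integral_const_mul]
    have := exp_mul_one_add_le (-(1 / 2 * meanProb ℓ P s.space))
    simpa [meanProb] using this

lemma IsSampling.tail_sumProb (hz : IsSampling P μ z)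
    (hℓ : ∀ z y, 0 ≤ ℓ z y ∧ ℓ z y ≤ 1) (δ : ℝ) (τ : ℕ) (H : Finset (X → Z)) (n : ℕ) (x : ℝ) :
    μ {ω | 5 / 4 * ∑ t ∈ Finset.range n, meanProb ℓ P (learner ℓ δ τ H z t ω).space +
      5 / 2 * x ≤ (learner ℓ δ τ H z n ω).sumProb} ≤ ENNReal.ofReal (Real.exp (-x)) := by
  refine (measure_mono ?_).trans (hz.tail hℓ δ τ H
    (fun s a => 2 / 5 * queryProb ℓ s.space a.1 + -(1 / 2 * meanProb ℓ P s.space))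
    (fun s a => 2 / 5 * queryProb ℓ s.space a.1 + -(1 / 2 * meanProb ℓ P s.space))
    (fun s a => Real.exp (-(1 / 2 * meanProb ℓ P s.space)) *
      (1 + 1 / 2 * queryProb ℓ s.space a.1))
    (fun s a => ?_) (fun s => ?_) n x)
  · intro ω hω
    simp only [Set.mem_ofPred_eq, ite_self] at hω ⊢
    rw [learner_sumProb] at hω
    rw [Finset.sum_add_distrib, Finset.sum_neg_distrib, ← Finset.mul_sum, ← Finset.mul_sum]
    simp only [roundProb] at hω
    linarith
  · have key := exp_two_fifths_mul_le (queryProb_nonneg (ℓ := ℓ) s.space a.1)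
      (queryProb_le_one hℓ s.space a.1)
    rw [Real.exp_add]
    set E := Real.exp (-(1 / 2 * meanProb ℓ P s.space))
    have hE : 0 < E := Real.exp_pos _
    nlinarith
  · rw [integral_const_mul, integral_add (integrable_const _) Integrable.of_finite,
      integral_const_mul]
    have := exp_mul_one_add_le (-(1 / 2 * meanProb ℓ P s.space))
    simpa [meanProb] using this

end Tails

/-! ### From fixed scales to the slack of the learner -/

section Confidence

/-- The scales at which the deviations are controlled. -/
noncomputable def scale (j : ℕ) : ℝ := 2 / 5 / 2 ^ j

/-- The variance constants of the scales. -/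
noncomputable def scaleConst (j : ℕ) : ℝ := if j = 0 then 24 / 25 else 67 / 100

lemma varConst_scale (j : ℕ) : VarConst (scaleConst j) (scale j) := by
  rcases Nat.eq_zero_or_pos j with rfl | hj
  · simpa [scale, scaleConst] using VarConst.two_fifths
  · rw [scaleConst, if_neg hj.ne']
    refine VarConst.of_le (by unfold scale; positivity) ?_
    have : (2 : ℝ) ^ 1 ≤ 2 ^ j := pow_le_pow_right₀ (by norm_num) hj
    rw [scale, div_le_iff₀ (by positivity)]
    linarith

/-- Among finitely many scales, one is good enough for the sum `a ^ 2` of the query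
probabilities. -/
lemma deviation_le_of_scales {a r l x x₁ dev : ℝ} {τ : ℕ} (ha : 0 ≤ a) (hr : 0 ≤ r) (hl : 1 ≤ l)
    (haτ : a ^ 2 ≤ τ) (hx₁r : x₁ ≤ r ^ 2) (hx₁l : x₁ ≤ l ^ 2) (hxl : x ≤ l ^ 2)
    (hxr : 2 * x ≤ l ^ 2 + r ^ 2) (hA : dev ≤ 11 / 5 * a ^ 2 + 10 * x₁)
    (hB : ∀ j ≤ Nat.log 4 τ, dev ≤ scaleConst j * scale j * a ^ 2 + x / scale j) :
    dev ≤ (2 * a + 12 * r) * l := by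
  -- Small sums: the class-free bound `hA` applies, with `11/5 * a² ≤ 2 a l` and `x₁ ≤ min (r²) (l²)
  -- ≤ r l`. The scales would cost a multiple of `x`, which `r l` need not dominate when `r` is much
  -- smaller than `l`.
  by_cases h1 : a ^ 2 ≤ 3 / 4 * l ^ 2
  · have h2 : a ≤ 10 / 11 * l := by
      refine abs_le_of_sq_le_sq' ?_ (by positivity) |>.2
      nlinarith
    have h3 : x₁ ≤ r * l := by
      rcases le_total r l with h | h <;> nlinarith
    nlinarith
  rw [not_le] at h1
  have h2 : 43 / 50 * l ≤ a := by
    refine abs_le_of_sq_le_sq' ?_ ha |>.2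
    nlinarith
  -- Medium sums: the largest scale `2/5`. For `r ≤ l`, `a²` is replaced by its chord between `43/50
  -- * l` and `4 l`, and `x` by the average of `l²` and `r²`.
  by_cases h3 : a ^ 2 ≤ 16 * l ^ 2
  · have h4 : a ≤ 4 * l := by
      refine abs_le_of_sq_le_sq' ?_ (by positivity) |>.2
      nlinarith
    have h5 := hB 0 (Nat.zero_le _)
    simp only [scaleConst, if_true, scale, pow_zero, div_one] at h5
    have h6 : x / (2 / 5) = 5 / 2 * x := by ring
    rw [h6] at h5
    rcases le_total r l with h | h
    · have : (a - 43 / 50 * l) * (a - 4 * l) ≤ 0 :=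
        mul_nonpos_of_nonneg_of_nonpos (by linarith) (by linarith)
      nlinarith
    · nlinarith
  rw [not_le] at h3
  -- Large sums: `j` is chosen so that `2^(j+1) l ≤ a ≤ 2^(j+2) l`, which makes the scale comparable
  -- to the optimal `l / a`. The chord of `a²` over this interval then suffices. That `j` is on the
  -- grid follows from `a² ≤ τ` and `1 ≤ l`.
  obtain ⟨j, hj1, hj2⟩ := exists_nat_pow_near (x := a ^ 2 / (4 * l ^ 2)) (y := 4)
    (by rw [one_le_div (by positivity)]; nlinarith) (by norm_num)
  rw [le_div_iff₀ (by positivity)] at hj1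
  rw [div_lt_iff₀ (by positivity), pow_succ (4 : ℝ) j] at hj2
  have hj0 : j ≠ 0 := by
    rintro rfl
    norm_num at hj2
    linarith
  have hjτ : j ≤ Nat.log 4 τ := by
    refine Nat.le_log_of_pow_le (by norm_num) ?_
    have h4 : (0 : ℝ) < 4 ^ j := by positivity
    have h4' : (4 : ℝ) ^ j * 1 ≤ 4 ^ j * (4 * l ^ 2) := by gcongr; nlinarith
    have : (4 : ℝ) ^ j ≤ τ := by linarith
    exact_mod_cast this
  have h5 := hB j hjτ
  rw [scaleConst, if_neg hj0, scale] at h5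
  obtain ⟨u, hu⟩ : ∃ u : ℝ, u = 2 ^ j := ⟨_, rfl⟩
  have hu4 : (4 : ℝ) ^ j = u ^ 2 := by rw [hu, ← pow_mul, mul_comm, pow_mul]; norm_num
  have hu0 : 0 < u := by rw [hu]; positivity
  rw [← hu] at h5
  rw [hu4] at hj1 hj2
  have h6 : 2 * (u * l) ≤ a := by
    refine abs_le_of_sq_le_sq' ?_ ha |>.2
    nlinarith
  have h7 : a ≤ 4 * (u * l) := by
    refine abs_le_of_sq_le_sq' ?_ (by positivity) |>.2
    nlinarith
  have h8 : x / (2 / 5 / u) = 5 / 2 * u * x := by field_simp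
  have h9 : 67 / 100 * (2 / 5 / u) * a ^ 2 = 67 / 250 * a ^ 2 / u := by ring
  rw [h8, h9] at h5
  have h10 : 67 / 250 * a ^ 2 / u ≤ 2 * a * l - 5 / 2 * u * l ^ 2 := by
    rw [div_le_iff₀ hu0]
    have : (a - 2 * (u * l)) * (a - 4 * (u * l)) ≤ 0 :=
      mul_nonpos_of_nonneg_of_nonpos (by linarith) (by linarith)
    have h11 : 0 < u * l := by positivity
    nlinarith
  have h12 : 5 / 2 * u * x ≤ 5 / 2 * u * l ^ 2 := by gcongr
  nlinarith

lemma log_natCast_lower_bound {τ : ℕ} (hτ : 2 ≤ τ) : 69 / 100 ≤ Real.log τ := by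
  have h : Real.log 2 ≤ Real.log τ :=
    Real.log_le_log (by norm_num) (by exact_mod_cast hτ)
  linarith [Real.log_two_gt_d9]

/-- Counts the scales. This is the source of `log τ` inside the logarithm of the slack. -/
lemma log_four_add_one_le {τ : ℕ} (hτ : 2 ≤ τ) : ((Nat.log 4 τ + 1 : ℕ) : ℝ) ≤ 3 * Real.log τ := by
  have h1 : (4 : ℝ) ^ Nat.log 4 τ ≤ τ := by
    exact_mod_cast Nat.pow_log_le_self 4 (by omega : τ ≠ 0)
  have h2 := Real.log_le_log (by positivity) h1
  rw [Real.log_pow] at h2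
  have h3 : (1 : ℝ) ≤ Real.log 4 := by
    rw [show (4 : ℝ) = 2 ^ 2 by norm_num, Real.log_pow]
    push_cast
    linarith [Real.log_two_gt_d9]
  have h4 : (Nat.log 4 τ : ℝ) ≤ Nat.log 4 τ * Real.log 4 :=
    le_mul_of_one_le_right (Nat.cast_nonneg _) h3
  push_cast
  linarith [log_natCast_lower_bound hτ]

variable {δ : ℝ} {τ m : ℕ}

/-- Squaring the left argument leaves, against the product of the right ones, only `36 log τ ≤ 32 (3
+ τ)`; the factor `3 + τ` absorbs the surplus `log τ`. -/
lemma two_log_le (hδ0 : 0 < δ) (hτ : 2 ≤ τ) (hm : 1 ≤ m) :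
    2 * Real.log (6 * τ ^ 2 * m * Real.log τ / δ) ≤
      Real.log (16 * τ ^ 2 * m ^ 2 * Real.log τ / δ) +
        Real.log (2 * (3 + τ) * τ ^ 2 / δ) := by
  have hl := log_natCast_lower_bound hτ
  have hl0 : 0 < Real.log τ := by linarith
  have hτ0 : (0 : ℝ) < τ := by positivity
  have hm0 : (0 : ℝ) < m := by exact_mod_cast hm
  have hlτ : Real.log τ ≤ τ / 2 := by
    have h1 := Real.log_le_sub_one_of_pos (half_pos hτ0)
    rw [Real.log_div hτ0.ne' two_ne_zero] at h1
    linarith [Real.log_two_lt_d9]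
  rw [← Real.log_mul (by positivity) (by positivity)]
  have : 2 * Real.log (6 * τ ^ 2 * m * Real.log τ / δ) =
      Real.log ((6 * τ ^ 2 * m * Real.log τ / δ) ^ 2) := by rw [Real.log_pow]; norm_num
  rw [this]
  refine Real.log_le_log (by positivity) ?_
  rw [div_mul_div_comm, div_pow, ← sq]
  gcongr
  have h0 : 0 ≤ (τ : ℝ) ^ 4 * m ^ 2 * Real.log τ := by positivity
  have h1 : 36 * Real.log τ ≤ 32 * (3 + τ) := by linarith
  have h2 := mul_le_mul_of_nonneg_left h1 h0
  calc _ = (τ : ℝ) ^ 4 * m ^ 2 * Real.log τ * (36 * Real.log τ) := by ring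
    _ ≤ _ := h2
    _ = _ := by ring

lemma log_le_log_sq (hδ0 : 0 < δ) (hτ : 2 ≤ τ) (hm : 1 ≤ m) :
    Real.log (6 * τ ^ 2 * m * Real.log τ / δ) ≤
      Real.log (16 * τ ^ 2 * m ^ 2 * Real.log τ / δ) := by
  have hl := log_natCast_lower_bound hτ
  have hl0 : 0 < Real.log τ := by linarith
  have hm1 : (1 : ℝ) ≤ m := by exact_mod_cast hm
  have hτ0 : (0 : ℝ) < τ := by positivity
  refine Real.log_le_log (by positivity) ?_
  gcongr
  · norm_num
  · nlinarith

lemma log_two_mul_le_left (hδ0 : 0 < δ) (hτ : 2 ≤ τ) :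
    Real.log (2 * τ ^ 2 / δ) ≤ Real.log (2 * (3 + τ) * τ ^ 2 / δ) := by
  have hτ0 : (0 : ℝ) < τ := by positivity
  refine Real.log_le_log (by positivity) ?_
  gcongr
  linarith

lemma log_two_mul_le_right (hδ0 : 0 < δ) (hτ : 2 ≤ τ) (hm : 1 ≤ m) :
    Real.log (2 * τ ^ 2 / δ) ≤ Real.log (16 * τ ^ 2 * m ^ 2 * Real.log τ / δ) := by
  have hl := log_natCast_lower_bound hτ
  have hm1 : (1 : ℝ) ≤ (m : ℝ) ^ 2 := one_le_pow₀ (by exact_mod_cast hm)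
  have hτ0 : (0 : ℝ) < τ := by positivity
  refine Real.log_le_log (by positivity) (div_le_div_of_nonneg_right ?_ hδ0.le)
  have : (1 : ℝ) * (69 / 100) ≤ m ^ 2 * Real.log τ := by gcongr
  have h2 : (0 : ℝ) ≤ (τ : ℝ) ^ 2 := by positivity
  nlinarith

lemma one_le_log_two_mul (hδ0 : 0 < δ) (hδ1 : δ ≤ 1) (hτ : 2 ≤ τ) :
    1 ≤ Real.log (2 * τ ^ 2 / δ) := by
  have hτ2 : (2 : ℝ) ≤ τ := by exact_mod_cast hτ
  rw [Real.le_log_iff_exp_le (by positivity), le_div_iff₀ hδ0]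
  have h1 := Real.exp_one_lt_d9
  have h2 : Real.exp 1 * δ ≤ Real.exp 1 := mul_le_of_le_one_right (Real.exp_pos _).le hδ1
  nlinarith

/-- The deviations allowed at all scales are within the slack of the learner. -/
lemma deviation_le_slack {S dev : ℝ} {t : ℕ} (hδ0 : 0 < δ) (hδ1 : δ ≤ 1) (hτ : 2 ≤ τ) (hm : 1 ≤ m)
    (ht : 0 < t) (hS0 : 0 ≤ S) (hSτ : S ≤ τ)
    (hA : dev ≤ 11 / 5 * S + 10 * Real.log (2 * τ ^ 2 / δ))
    (hB : ∀ j ≤ Nat.log 4 τ, dev ≤ scaleConst j * scale j * S +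
      Real.log (6 * τ ^ 2 * m * Real.log τ / δ) / scale j) :
    dev ≤ t * (2 * slack δ τ m t S) := by
  have h1 := one_le_log_two_mul hδ0 hδ1 hτ
  have h2 := log_two_mul_le_left hδ0 hτ
  have h3 := log_two_mul_le_right hδ0 hτ hm
  have ht' : (t : ℝ) ≠ 0 := by positivity
  have e : t * (2 * slack δ τ m t S) = (2 * √S + 12 * √(Real.log (2 * (3 + τ) * τ ^ 2 / δ))) *
      √(Real.log (16 * τ ^ 2 * m ^ 2 * Real.log τ / δ)) := by
    unfold slack; field_simp; ring
  rw [e]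
  refine deviation_le_of_scales (x := Real.log (6 * τ ^ 2 * m * Real.log τ / δ))
    (x₁ := Real.log (2 * τ ^ 2 / δ)) (τ := τ) (Real.sqrt_nonneg _) (Real.sqrt_nonneg _)
    (Real.one_le_sqrt.2 (by linarith)) ?_ ?_ ?_ ?_ ?_ ?_ ?_
  · rwa [Real.sq_sqrt hS0]
  · rwa [Real.sq_sqrt (by linarith)]
  · rwa [Real.sq_sqrt (by linarith)]
  · rw [Real.sq_sqrt (by linarith)]; exact log_le_log_sq hδ0 hτ hm
  · rw [Real.sq_sqrt (by linarith), Real.sq_sqrt (by linarith)]; exact two_log_le hδ0 hτ hm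
  · rwa [Real.sq_sqrt hS0]
  · rwa [Real.sq_sqrt hS0]

end Confidence

/-! ### Uniform reliability of the empirical comparisons -/

section Deviations

variable {X Y Z Ω : Type*} [Fintype X] [MeasurableSpace X] [MeasurableSingletonClass X]
  [Fintype Y] [MeasurableSpace Y] [MeasurableSingletonClass Y] [MeasurableSpace Ω]

/-- The event that, for all hypotheses that are still in the version space with `hs`, the
empirical advantage over `hs` exceeds the true one by no more than the allowed slack. -/
def reliable (ℓ : Z → Y → ℝ) (δ : ℝ) (τ : ℕ) (H : Finset (X → Z)) (z : ℕ → Ω → (X × Y) × ℝ)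
    (P : Measure (X × Y)) (hs : X → Z) : Set Ω :=
  {ω | ∀ n < τ, ∀ g, hs ∈ (learner ℓ δ τ H z n ω).space → g ∈ (learner ℓ δ τ H z n ω).space →
    (learner ℓ δ τ H z (n + 1) ω).cumLoss hs - (learner ℓ δ τ H z (n + 1) ω).cumLoss g +
      (n + 1) * (risk ℓ P g - risk ℓ P hs) ≤
    ((n + 1 : ℕ) : ℝ) *
      (2 * slack δ τ H.card (n + 1) (learner ℓ δ τ H z (n + 1) ω).sumProb)}

variable {P : Measure (X × Y)} [IsProbabilityMeasure P] {μ : Measure Ω} [IsProbabilityMeasure μ]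
  {z : ℕ → Ω → (X × Y) × ℝ} {ℓ : Z → Y → ℝ} {δ : ℝ} {τ : ℕ}

omit [Fintype X] [MeasurableSpace X] [MeasurableSingletonClass X] [Fintype Y] [MeasurableSpace Y]
  [MeasurableSingletonClass Y] [MeasurableSpace Ω] in
lemma learner_sumProb_nonneg (ℓ : Z → Y → ℝ) (δ : ℝ) (τ : ℕ) (H : Finset (X → Z))
    (z : ℕ → Ω → (X × Y) × ℝ) (t : ℕ) (ω : Ω) : 0 ≤ (learner ℓ δ τ H z t ω).sumProb := by
  rw [learner_sumProb]
  exact Finset.sum_nonneg fun _ _ => queryProb_nonneg _ _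

omit [Fintype X] [MeasurableSpace X] [MeasurableSingletonClass X] [Fintype Y] [MeasurableSpace Y]
  [MeasurableSingletonClass Y] [MeasurableSpace Ω] in
lemma learner_sumProb_mono (ℓ : Z → Y → ℝ) (δ : ℝ) (τ : ℕ) (H : Finset (X → Z))
    (z : ℕ → Ω → (X × Y) × ℝ) {s t : ℕ} (h : s ≤ t) (ω : Ω) :
    (learner ℓ δ τ H z s ω).sumProb ≤ (learner ℓ δ τ H z t ω).sumProb := by
  rw [learner_sumProb, learner_sumProb]
  exact Finset.sum_le_sum_of_subset_of_nonneg (Finset.range_mono h)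
    fun _ _ _ => queryProb_nonneg _ _

omit [Fintype X] [MeasurableSpace X] [MeasurableSingletonClass X] [Fintype Y] [MeasurableSpace Y]
  [MeasurableSingletonClass Y] [MeasurableSpace Ω] in
lemma learner_sumProb_le (hℓ : ∀ z y, 0 ≤ ℓ z y ∧ ℓ z y ≤ 1) (δ : ℝ) (τ : ℕ) (H : Finset (X → Z))
    (z : ℕ → Ω → (X × Y) × ℝ) (t : ℕ) (ω : Ω) : (learner ℓ δ τ H z t ω).sumProb ≤ t := by
  rw [learner_sumProb]
  calc _ ≤ ∑ _s ∈ Finset.range t, (1 : ℝ) :=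
        Finset.sum_le_sum fun _ _ => queryProb_le_one hℓ _ _
    _ = t := by simp

omit [MeasurableSpace Ω] in
-- A queried round changes the weighted loss difference by at most `p / p`, and the risk difference
-- is at most the mean query probability, both by membership in the version space.
lemma deviation_le_queries_add_mean {H : Finset (X → Z)} {hs g : X → Z} {n : ℕ} {ω : Ω}
    (hhs : hs ∈ (learner ℓ δ τ H z n ω).space) (hg : g ∈ (learner ℓ δ τ H z n ω).space) :
    (learner ℓ δ τ H z (n + 1) ω).cumLoss hs - (learner ℓ δ τ H z (n + 1) ω).cumLoss g +
      (n + 1) * (risk ℓ P g - risk ℓ P hs) ≤ (learner ℓ δ τ H z (n + 1) ω).queries +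
        ∑ t ∈ Finset.range (n + 1), meanProb ℓ P (learner ℓ δ τ H z t ω).space := by
  rw [learner_cumLoss, learner_cumLoss, learner_queries, ← Finset.sum_sub_distrib]
  have h1 : ((n : ℝ) + 1) * (risk ℓ P g - risk ℓ P hs) =
      ∑ _t ∈ Finset.range (n + 1), (risk ℓ P g - risk ℓ P hs) := by
    rw [Finset.sum_const, Finset.card_range, nsmul_eq_mul]; push_cast; ring
  rw [h1]
  push_cast
  refine add_le_add (Finset.sum_le_sum fun t ht => ?_) (Finset.sum_le_sum fun t ht => ?_)
  · have ht' : t ≤ n := Nat.lt_succ_iff.1 (Finset.mem_range.1 ht)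
    have h2 := abs_sub_le_queryProb (ℓ := ℓ) (learner_space_anti ℓ δ τ H z ω ht' hhs)
      (learner_space_anti ℓ δ τ H z ω ht' hg) (z t ω).1.1 (z t ω).1.2
    have h3 : roundProb ℓ δ τ H z t ω =
      queryProb ℓ (learner ℓ δ τ H z t ω).space (z t ω).1.1 := rfl
    rw [← h3] at h2
    have h4 : (0 : ℝ) ≤ roundCoin ℓ δ τ H z t ω := Nat.cast_nonneg _
    have h5 : 0 ≤ roundProb ℓ δ τ H z t ω := (abs_nonneg _).trans h2
    rw [← mul_sub]
    calc _ ≤ (roundCoin ℓ δ τ H z t ω : ℝ) / roundProb ℓ δ τ H z t ω *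
          roundProb ℓ δ τ H z t ω := by
          gcongr
          exact (le_abs_self _).trans h2
      _ = roundCoin ℓ δ τ H z t ω * (roundProb ℓ δ τ H z t ω / roundProb ℓ δ τ H z t ω) := by
          ring
      _ ≤ _ := mul_le_of_le_one_right h4 (div_self_le_one _)
  · have ht' : t ≤ n := Nat.lt_succ_iff.1 (Finset.mem_range.1 ht)
    exact risk_sub_le_meanProb (learner_space_anti ℓ δ τ H z ω ht' hg)
      (learner_space_anti ℓ δ τ H z ω ht' hhs)

/-- Union over `τ` rounds: the class-free event costs `δ / (2 τ²)` per round, and the `m` hypotheses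
on at most `3 log τ` scales cost `δ / (6 τ² m log τ)` each. Both parts sum to at most `δ / (2 τ)`;
the remaining `1 / τ` serves for combining the clusters. -/
lemma IsSampling.measure_compl_reliable_le (hz : IsSampling P μ z)
    (hℓ : ∀ z y, 0 ≤ ℓ z y ∧ ℓ z y ≤ 1) (hδ0 : 0 < δ) (hδ1 : δ ≤ 1) (hτ : 2 ≤ τ)
    {H : Finset (X → Z)} {hs : X → Z} (hH : hs ∈ H) :
    μ (reliable ℓ δ τ H z P hs)ᶜ ≤ ENNReal.ofReal (δ / τ) := by
  set m := H.card with hm_def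
  have hm : 1 ≤ m := Finset.card_pos.2 ⟨hs, hH⟩
  set x := Real.log (6 * τ ^ 2 * m * Real.log τ / δ) with hx
  set x₁ := Real.log (2 * τ ^ 2 / δ) with hx₁
  set J := Nat.log 4 τ + 1 with hJ
  set A : ℕ → Set Ω := fun n => {ω | 11 / 5 * (learner ℓ δ τ H z (n + 1) ω).sumProb + 10 * x₁ ≤
      (learner ℓ δ τ H z (n + 1) ω).queries +
        ∑ t ∈ Finset.range (n + 1), meanProb ℓ P (learner ℓ δ τ H z t ω).space} with hA
  set B : ℕ → (X → Z) → ℕ → Set Ω := fun n g j =>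
    {ω | hs ∈ (learner ℓ δ τ H z n ω).space ∧ g ∈ (learner ℓ δ τ H z n ω).space ∧
      scaleConst j * scale j * (learner ℓ δ τ H z (n + 1) ω).sumProb + x / scale j ≤
        (learner ℓ δ τ H z (n + 1) ω).cumLoss hs - (learner ℓ δ τ H z (n + 1) ω).cumLoss g +
          (n + 1) * (risk ℓ P g - risk ℓ P hs)} with hB
  have hsub : (reliable ℓ δ τ H z P hs)ᶜ ⊆
      ⋃ n ∈ Finset.range τ, (A n ∪ ⋃ g ∈ H, ⋃ j ∈ Finset.range J, B n g j) := by
    intro ω hω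
    by_contra hno
    refine hω fun n hn g hhs hg => ?_
    simp only [Set.mem_iUnion, Set.mem_union, Finset.mem_range, not_exists, not_or] at hno
    obtain ⟨hnA, hnB⟩ := hno n hn
    refine deviation_le_slack hδ0 hδ1 hτ hm n.succ_pos (learner_sumProb_nonneg ..)
      ((learner_sumProb_le hℓ ..).trans (by exact_mod_cast hn)) ?_ fun j hj => ?_
    · simp only [hA, Set.mem_ofPred_eq, not_le] at hnA
      exact (deviation_le_queries_add_mean hhs hg).trans hnA.le
    · have := hnB g (learner_space_subset ℓ δ τ H z n ω hg) j (Nat.lt_succ_of_le hj)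
      simp only [hB, Set.mem_ofPred_eq, not_and, not_le] at this
      exact (this hhs hg).le
  have hl := log_natCast_lower_bound hτ
  have hl0 : 0 < Real.log τ := by linarith
  have hτ0 : (0 : ℝ) < τ := by positivity
  have hm0 : (0 : ℝ) < m := by exact_mod_cast hm
  have ex : Real.exp (-x) = δ / (6 * τ ^ 2 * m * Real.log τ) := by
    rw [hx, Real.exp_neg, Real.exp_log (by positivity), inv_div]
  have ex₁ : Real.exp (-x₁) = δ / (2 * τ ^ 2) := by
    rw [hx₁, Real.exp_neg, Real.exp_log (by positivity), inv_div]
  have hJ' := log_four_add_one_le hτ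
  calc μ (reliable ℓ δ τ H z P hs)ᶜ
      ≤ ∑ n ∈ Finset.range τ, μ (A n ∪ ⋃ g ∈ H, ⋃ j ∈ Finset.range J, B n g j) :=
        (measure_mono hsub).trans (measure_biUnion_finset_le _ _)
    _ ≤ ∑ n ∈ Finset.range τ, (ENNReal.ofReal (Real.exp (-x₁)) +
          ∑ g ∈ H, ∑ j ∈ Finset.range J, ENNReal.ofReal (Real.exp (-x))) := by
        refine Finset.sum_le_sum fun n _ => (measure_union_le _ _).trans (add_le_add ?_ ?_)
        · exact hz.tail_queries_add_mean hℓ δ τ H (n + 1) x₁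
        · refine (measure_biUnion_finset_le _ _).trans (Finset.sum_le_sum fun g _ => ?_)
          refine (measure_biUnion_finset_le _ _).trans (Finset.sum_le_sum fun j _ => ?_)
          exact hz.tail_deviation hℓ δ τ H (varConst_scale j) hs g n x
    _ = ENNReal.ofReal (τ * (Real.exp (-x₁) + m * (J * Real.exp (-x)))) := by
        have e0 := Real.exp_pos (-x)
        have e1 := Real.exp_pos (-x₁)
        simp only [Finset.sum_const, Finset.card_range, nsmul_eq_mul, ← hm_def]
        rw [ENNReal.ofReal_mul hτ0.le, ENNReal.ofReal_add e1.le (by positivity),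
          ENNReal.ofReal_mul hm0.le, ENNReal.ofReal_mul (Nat.cast_nonneg _)]
        simp only [ENNReal.ofReal_natCast]
    _ ≤ ENNReal.ofReal (δ / τ) := by
        refine ENNReal.ofReal_le_ofReal ?_
        rw [ex, ex₁]
        have : (J : ℝ) * (δ / (6 * τ ^ 2 * m * Real.log τ)) ≤
            (3 * Real.log τ) * (δ / (6 * τ ^ 2 * m * Real.log τ)) := by gcongr
        calc _ ≤ τ * (δ / (2 * τ ^ 2) +
              m * ((3 * Real.log τ) * (δ / (6 * τ ^ 2 * m * Real.log τ)))) := by gcongr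
          _ = δ / τ := by field_simp; norm_num

end Deviations

/-! ### Survival of the optimum and excess risk -/

section Excess

variable {X Y Z Ω : Type*} [MeasurableSpace X] [MeasurableSpace Y]
  {P : Measure (X × Y)} {z : ℕ → Ω → (X × Y) × ℝ} {ℓ : Z → Y → ℝ} {δ : ℝ} {τ : ℕ}
  {H : Finset (X → Z)} {hs : X → Z} {ω : Ω}

/-- No competitor has smaller risk, so reliability caps its empirical advantage over `hs` by exactly
the margin of the elimination rule. -/
lemma mem_space_of_reliable (hH : hs ∈ H) (hopt : ∀ g ∈ H, risk ℓ P hs ≤ risk ℓ P g)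
    (hω : ω ∈ reliable ℓ δ τ H z P hs) {n : ℕ} (hn : n ≤ τ) :
    hs ∈ (learner ℓ δ τ H z n ω).space := by
  induction n with
  | zero => exact hH
  | succ n ih =>
    have h1 := ih (by omega)
    refine (mem_learner_space_succ ..).2 ⟨h1, fun g hg => ?_⟩
    have h2 := hω n hn g h1 hg
    have h3 := hopt g (learner_space_subset ℓ δ τ H z n ω hg)
    have h4 : (0 : ℝ) < ((n + 1 : ℕ) : ℝ) := by positivity
    rw [div_le_iff₀ h4, add_mul, div_mul_cancel₀ _ h4.ne']
    have h5 : 0 ≤ ((n : ℝ) + 1) * (risk ℓ P g - risk ℓ P hs) :=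
      mul_nonneg (by positivity) (by linarith)
    linarith

/-- The factor `4` is `2` for the elimination margin against `hs` plus `2` for reliability. An
output does not lose to `hs` empirically, so only the second `2` remains for it. -/
lemma excess_le_of_reliable (hH : hs ∈ H) (hopt : ∀ g ∈ H, risk ℓ P hs ≤ risk ℓ P g)
    (hω : ω ∈ reliable ℓ δ τ H z P hs) {n : ℕ} (hn : n < τ) {f : X → Z}
    (hf : f ∈ (learner ℓ δ τ H z (n + 1) ω).space) :
    risk ℓ P f - risk ℓ P hs ≤
      4 * slack δ τ H.card (n + 1) (learner ℓ δ τ H z (n + 1) ω).sumProb := by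
  have h1 := mem_space_of_reliable hH hopt hω hn.le
  obtain ⟨h2, h3⟩ := (mem_learner_space_succ ..).1 hf
  have h4 := hω n hn f h1 h2
  have h5 := h3 hs h1
  have h6 : (0 : ℝ) < ((n + 1 : ℕ) : ℝ) := by positivity
  rw [div_le_iff₀ h6, add_mul, div_mul_cancel₀ _ h6.ne'] at h5
  refine le_of_mul_le_mul_left ?_ h6
  push_cast at *
  linarith

lemma excess_output_le_of_reliable (hτ : 0 < τ) (hH : hs ∈ H)
    (hopt : ∀ g ∈ H, risk ℓ P hs ≤ risk ℓ P g)
    (hω : ω ∈ reliable ℓ δ τ H z P hs) {f : X → Z} (hf : f ∈ (learner ℓ δ τ H z τ ω).outputs) :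
    risk ℓ P f - risk ℓ P hs ≤
      2 * slack δ τ H.card τ (learner ℓ δ τ H z τ ω).sumProb := by
  obtain ⟨n, rfl⟩ : ∃ n, τ = n + 1 := ⟨τ - 1, by omega⟩
  have h1 := mem_space_of_reliable hH hopt hω n.le_succ
  have h2 := hf.2 hs (mem_space_of_reliable hH hopt hω le_rfl)
  have h3 := hω n n.lt_succ_self f h1 ((mem_learner_space_succ ..).1 hf.1).1
  have h6 : (0 : ℝ) < ((n + 1 : ℕ) : ℝ) := by positivity
  refine le_of_mul_le_mul_left ?_ h6
  push_cast at *
  linarith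

end Excess

/-! ### Number of queries in one cluster -/

section LabelComplexity

/-- The constant of the lower-order terms of the label complexity bound. -/
noncomputable def labelConst (θ K : ℝ) : ℝ := 10000 * (1 + θ) ^ 2 * (1 + K) ^ 2

variable {δ : ℝ} {τ m N : ℕ}

lemma logFactor_lower (hδ0 : 0 < δ) (hm : 1 ≤ m) (hN : 1 ≤ N) :
    (τ : ℝ) / δ ≤ τ * m * N / δ := by
  have hm1 : (1 : ℝ) ≤ m := by exact_mod_cast hm
  have hN1 : (1 : ℝ) ≤ N := by exact_mod_cast hN
  gcongr
  have : (τ : ℝ) * 1 * 1 ≤ τ * m * N := by gcongr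
  linarith

/-- Lets numerical factors be absorbed into powers of the argument of the logarithm, for example `16
y³ ≤ y⁵`. The case `1/2 ≤ δ` is trivial for the label bound. -/
lemma four_le_logFactor (hδ0 : 0 < δ) (hδ1 : δ < 1 / 2) (hτ : 2 ≤ τ) (hm : 1 ≤ m) (hN : 1 ≤ N) :
    (4 : ℝ) ≤ τ * m * N / δ := by
  have hτ2 : (2 : ℝ) ≤ τ := by exact_mod_cast hτ
  refine le_trans ?_ (logFactor_lower hδ0 hm hN)
  rw [le_div_iff₀ hδ0]
  linarith

lemma one_le_lg (hδ0 : 0 < δ) (hδ1 : δ < 1 / 2) (hτ : 2 ≤ τ) (hm : 1 ≤ m) (hN : 1 ≤ N) :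
    1 ≤ Real.log (τ * m * N / δ) := by
  have h4 := four_le_logFactor hδ0 hδ1 hτ hm hN
  rw [Real.le_log_iff_exp_le (by linarith)]
  linarith [Real.exp_one_lt_d9]

lemma log_le_lg (hδ0 : 0 < δ) (hδ1 : δ < 1 / 2) (hτ : 2 ≤ τ) (hm : 1 ≤ m) (hN : 1 ≤ N) :
    Real.log τ ≤ Real.log (τ * m * N / δ) := by
  have hτ0 : (0 : ℝ) < τ := by positivity
  refine Real.log_le_log hτ0 (le_trans ?_ (logFactor_lower hδ0 hm hN))
  rw [le_div_iff₀ hδ0]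
  nlinarith

lemma log_two_mul_le_lg (hδ0 : 0 < δ) (hδ1 : δ < 1 / 2) (hτ : 2 ≤ τ) (hm : 1 ≤ m) (hN : 1 ≤ N) :
    Real.log (2 * τ / δ) ≤ 2 * Real.log (τ * m * N / δ) := by
  have hτ0 : (0 : ℝ) < τ := by positivity
  have h4 := four_le_logFactor hδ0 hδ1 hτ hm hN
  have h1 := logFactor_lower (τ := τ) hδ0 hm hN
  have e : 2 * Real.log (τ * m * N / δ) = Real.log ((τ * m * N / δ) ^ 2) := by
    rw [Real.log_pow]; norm_num
  rw [e]
  refine Real.log_le_log (by positivity) ?_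
  calc 2 * τ / δ = 2 * (τ / δ) := by ring
    _ ≤ (τ * m * N / δ) * (τ * m * N / δ) := by gcongr; linarith
    _ = _ := by ring

lemma log_confidence_le_lg (hδ0 : 0 < δ) (hδ1 : δ < 1 / 2) (hτ : 2 ≤ τ) (hm : 1 ≤ m)
    (hN : 1 ≤ N) :
    Real.log (2 * (3 + τ) * τ ^ 2 / δ) ≤ 5 * Real.log (τ * m * N / δ) := by
  have hτ0 : (0 : ℝ) < τ := by positivity
  have hτ2 : (2 : ℝ) ≤ τ := by exact_mod_cast hτ
  have h4 := four_le_logFactor hδ0 hδ1 hτ hm hN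
  have h1 := logFactor_lower (τ := τ) hδ0 hm hN
  set y := τ * m * N / δ
  have e : 5 * Real.log y = Real.log (y ^ 5) := by rw [Real.log_pow]; norm_num
  rw [e]
  refine Real.log_le_log (by positivity) ?_
  have h2 : (τ : ℝ) ≤ y := le_trans (by rw [le_div_iff₀ hδ0]; nlinarith) h1
  calc 2 * (3 + τ) * τ ^ 2 / δ = 2 * (3 + τ) * τ * (τ / δ) := by ring
    _ ≤ 2 * (4 * y) * y * y := by gcongr; linarith
    _ = 8 * y ^ 3 := by ring
    _ ≤ (y * y) * y ^ 3 := by gcongr; nlinarith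
    _ = y ^ 5 := by ring

lemma log_class_le_lg (hδ0 : 0 < δ) (hδ1 : δ < 1 / 2) (hτ : 2 ≤ τ) (hm : 1 ≤ m)
    (hN : 1 ≤ N) :
    Real.log (16 * τ ^ 2 * m ^ 2 * Real.log τ / δ) ≤ 5 * Real.log (τ * m * N / δ) := by
  have hτ0 : (0 : ℝ) < τ := by positivity
  have hm1 : (1 : ℝ) ≤ m := by exact_mod_cast hm
  have hN1 : (1 : ℝ) ≤ N := by exact_mod_cast hN
  have h4 := four_le_logFactor hδ0 hδ1 hτ hm hN
  have h1 := logFactor_lower (τ := τ) hδ0 hm hN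
  have hl := log_natCast_lower_bound hτ
  have hl0 : 0 < Real.log τ := by linarith
  have h2 : (τ : ℝ) * m ≤ τ * m * N / δ := by
    rw [le_div_iff₀ hδ0]
    have : (τ : ℝ) * m * δ ≤ τ * m * 1 := by gcongr; linarith
    have : (τ : ℝ) * m * 1 ≤ τ * m * N := by gcongr
    linarith
  set y := τ * m * N / δ
  have e : 5 * Real.log y = Real.log (y ^ 5) := by rw [Real.log_pow]; norm_num
  rw [e]
  refine Real.log_le_log (by positivity) ?_
  have h3 : Real.log τ ≤ τ := (Real.log_le_sub_one_of_pos hτ0).trans (by linarith)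
  calc 16 * τ ^ 2 * m ^ 2 * Real.log τ / δ ≤ 16 * τ ^ 2 * m ^ 2 * τ / δ := by gcongr
    _ = 16 * (τ * m) * (τ * m) * (τ / δ) := by ring
    _ ≤ 16 * y * y * y := by gcongr
    _ = 16 * y ^ 3 := by ring
    _ ≤ (y * y) * y ^ 3 := by gcongr; nlinarith
    _ = y ^ 5 := by ring

lemma slack_le {t : ℕ} {S S' : ℝ} (hδ0 : 0 < δ) (hδ1 : δ < 1 / 2) (hτ : 2 ≤ τ)
    (hm : 1 ≤ m) (hN : 1 ≤ N) (hS : S ≤ S') :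
    slack δ τ m t S ≤ 1 / t * ((√S' + 6 * √(5 * Real.log (τ * m * N / δ))) *
      √(5 * Real.log (τ * m * N / δ))) := by
  rw [slack, mul_assoc]
  gcongr
  · exact log_confidence_le_lg hδ0 hδ1 hτ hm hN
  · exact log_class_le_lg hδ0 hδ1 hτ hm hN

lemma slack_pos {t : ℕ} {S : ℝ} (hδ0 : 0 < δ) (hδ1 : δ ≤ 1) (hτ : 2 ≤ τ)
    (hm : 1 ≤ m) (ht : 0 < t) : 0 < slack δ τ m t S := by
  have h1 := one_le_log_two_mul hδ0 hδ1 hτ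
  have h2 := log_two_mul_le_left hδ0 hτ
  have h3 := log_two_mul_le_right hδ0 hτ hm
  have h4 : 0 < √(Real.log (2 * (3 + τ) * τ ^ 2 / δ)) := Real.sqrt_pos.2 (by linarith)
  have h5 : 0 < √(Real.log (16 * τ ^ 2 * m ^ 2 * Real.log τ / δ)) := Real.sqrt_pos.2 (by linarith)
  unfold slack
  positivity

lemma sum_one_div_le (hτ : 1 ≤ τ) :
    ∑ t ∈ Finset.range (τ - 1), 1 / ((t + 1 : ℕ) : ℝ) ≤ 1 + Real.log τ := by
  have h1 := harmonic_le_one_add_log (τ - 1)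
  have h2 : ((harmonic (τ - 1) : ℚ) : ℝ) =
      ∑ t ∈ Finset.range (τ - 1), 1 / ((t + 1 : ℕ) : ℝ) := by
    simp [harmonic]
  rw [← h2]
  rcases Nat.eq_zero_or_pos (τ - 1) with h | h
  · rw [h]
    simp only [harmonic_zero, Rat.cast_zero]
    have := Real.log_nonneg (x := (τ : ℝ)) (by exact_mod_cast hτ)
    linarith
  · refine h1.trans ?_
    gcongr
    omega

/-- The self-bounding inequality of the expected number `E` of queries, solved for the number
`Q` of queries. -/
lemma queries_le_of_selfBounding {θ K R t lg E S Q : ℝ} (hθ : 0 ≤ θ) (hK : 1 ≤ K) (hR : 0 ≤ R)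
    (ht : 0 ≤ t) (hlg : 1 ≤ lg) (hS0 : 0 ≤ S)
    (hE : E ≤ 1 + 4 * (θ * K) * R * t +
      16 * (θ * K) * lg * ((√S + 6 * √(5 * lg)) * √(5 * lg)))
    (hS : S ≤ 5 / 4 * E + 5 * lg) (hQ : Q ≤ 5 / 4 * E + 5 * lg) :
    Q ≤ 8 * (K * (θ * R * t + labelConst θ K * lg ^ 3)) - 1 := by
  obtain ⟨B, hB⟩ : ∃ B, B = θ * K := ⟨_, rfl⟩
  have hB0 : 0 ≤ B := by rw [hB]; positivity
  rw [← hB] at hE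
  have e1 : √(5 * lg) ^ 2 = 5 * lg := Real.sq_sqrt (by linarith)
  have e2 : √S ^ 2 = S := Real.sq_sqrt hS0
  -- The weight `100` in the arithmetic-geometric mean inequality leaves `2/25 * S`, hence only `E /
  -- 10` after `S ≤ 5/4 * E + 5 lg`, which the left side absorbs.
  have h1 : 16 * B * lg * (√S * √(5 * lg)) ≤ 2 / 25 * S + 4000 * B ^ 2 * lg ^ 3 := by
    have h2 := sq_nonneg (√S - 100 * (B * lg * √(5 * lg)))
    have h3 : (√S - 100 * (B * lg * √(5 * lg))) ^ 2 =
        √S ^ 2 - 200 * (B * lg * (√S * √(5 * lg))) +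
          10000 * B ^ 2 * lg ^ 2 * √(5 * lg) ^ 2 := by ring
    rw [h3, e1, e2] at h2
    nlinarith
  have h4 : 16 * B * lg * ((√S + 6 * √(5 * lg)) * √(5 * lg)) =
      16 * B * lg * (√S * √(5 * lg)) + 96 * B * lg * √(5 * lg) ^ 2 := by ring
  rw [h4, e1] at hE
  have hl2 : lg ≤ lg ^ 3 := le_self_pow₀ hlg (by norm_num)
  have hl3 : lg ^ 2 ≤ lg ^ 3 := pow_le_pow_right₀ hlg (by norm_num)
  have hl4 : 1 ≤ lg ^ 3 := hlg.trans hl2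
  have h5 : 96 * B * lg * (5 * lg) ≤ 480 * B * lg ^ 3 := by
    calc _ = 480 * B * lg ^ 2 := by ring
      _ ≤ _ := by gcongr
  have hBRt : 0 ≤ B * R * t := by positivity
  have h6 : Q ≤ 6 * (B * R * t) + (10 + 1000 * B + 6000 * B ^ 2) * lg ^ 3 := by
    have : 0 ≤ B * lg ^ 3 := by positivity
    have : 0 ≤ B ^ 2 * lg ^ 3 := by positivity
    nlinarith
  have h7 : 1 + B ≤ (1 + θ) * (1 + K) := by rw [hB]; nlinarith
  have h8 : (1 + B) ^ 2 ≤ ((1 + θ) * (1 + K)) ^ 2 := by gcongr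
  have h9 : 10000 * (1 + B) ^ 2 ≤ K * labelConst θ K := by
    have e : labelConst θ K = 10000 * ((1 + θ) * (1 + K)) ^ 2 := by unfold labelConst; ring
    rw [e]
    nlinarith [sq_nonneg ((1 + θ) * (1 + K))]
  have h10 : (8 * (10000 * (1 + B) ^ 2)) * lg ^ 3 ≤ 8 * (K * labelConst θ K) * lg ^ 3 := by
    gcongr
  have e3 : 8 * (K * (θ * R * t + labelConst θ K * lg ^ 3)) =
      8 * (B * R * t) + 8 * (K * labelConst θ K) * lg ^ 3 := by rw [hB]; ring
  rw [e3]
  -- The additional `lg ^ 3 ≥ 1` pays for the `- 1` of the claim, which is needed when the clusters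
  -- are combined.
  have h11 : (10 + 1000 * B + 6000 * B ^ 2) * lg ^ 3 + lg ^ 3 ≤
      (8 * (10000 * (1 + B) ^ 2)) * lg ^ 3 := by
    rw [← add_one_mul]
    gcongr
    nlinarith
  linarith

variable {X Y Z Ω : Type*} [Fintype X] [MeasurableSpace X] [MeasurableSingletonClass X]
  [Fintype Y] [MeasurableSpace Y] [MeasurableSingletonClass Y] [MeasurableSpace Ω]
  {P : Measure (X × Y)} [IsProbabilityMeasure P] {μ : Measure Ω} [IsProbabilityMeasure μ]
  {z : ℕ → Ω → (X × Y) × ℝ} {ℓ : Z → Y → ℝ}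

lemma meanProb_le_one (hℓ : ∀ z y, 0 ≤ ℓ z y ∧ ℓ z y ≤ 1) (V : Finset (X → Z)) :
    meanProb ℓ P V ≤ 1 := by
  have : meanProb ℓ P V ≤ ∫ _a, (1 : ℝ) ∂P :=
    integral_mono Integrable.of_finite Integrable.of_finite fun a => queryProb_le_one hℓ V a.1
  simpa using this

omit [MeasurableSpace Ω] in
-- `hmean` converts the excess risk `4 Δ_t` of the survivors into a mean query probability. Bounding
-- every partial sum by the final one leaves `1 / t` as the only dependence on the round, and the
-- harmonic sum is at most `2 lg`.
lemma sum_meanProb_le (hℓ : ∀ z y, 0 ≤ ℓ z y ∧ ℓ z y ≤ 1) (hδ0 : 0 < δ) (hδ1 : δ < 1 / 2)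
    (hτ : 2 ≤ τ) (hN : 1 ≤ N) {H : Finset (X → Z)} {hs : X → Z} (hH : hs ∈ H)
    (hopt : ∀ g ∈ H, risk ℓ P hs ≤ risk ℓ P g) {B : ℝ} (hB : 0 ≤ B)
    (hmean : ∀ V ⊆ H, hs ∈ V → ∀ D > 0, (∀ f ∈ V, risk ℓ P f - risk ℓ P hs ≤ D) →
      meanProb ℓ P V ≤ 2 * B * (2 * risk ℓ P hs + D)) {ω : Ω}
    (hω : ω ∈ reliable ℓ δ τ H z P hs) :
    ∑ t ∈ Finset.range τ, meanProb ℓ P (learner ℓ δ τ H z t ω).space ≤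
      1 + 4 * B * risk ℓ P hs * τ + 16 * B * Real.log (τ * H.card * N / δ) *
        ((√((learner ℓ δ τ H z τ ω).sumProb) + 6 * √(5 * Real.log (τ * H.card * N / δ))) *
          √(5 * Real.log (τ * H.card * N / δ))) := by
  have hm : 1 ≤ H.card := Finset.card_pos.2 ⟨hs, hH⟩
  have hR : 0 ≤ risk ℓ P hs := integral_nonneg fun a => (hℓ _ _).1
  obtain ⟨n, rfl⟩ : ∃ n, τ = n + 1 := ⟨τ - 1, by omega⟩
  set lg := Real.log (((n + 1 : ℕ) : ℝ) * H.card * N / δ) with hlg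
  set G := (√((learner ℓ δ (n + 1) H z (n + 1) ω).sumProb) + 6 * √(5 * lg)) * √(5 * lg) with hG
  have hG0 : 0 ≤ G := by positivity
  have h1 : ∀ t ∈ Finset.range n,
      meanProb ℓ P (learner ℓ δ (n + 1) H z (t + 1) ω).space ≤
        4 * B * risk ℓ P hs + 8 * B * G * (1 / ((t + 1 : ℕ) : ℝ)) := by
    intro t ht
    have ht' : t < n := Finset.mem_range.1 ht
    have h2 := hmean _ (learner_space_subset ℓ δ (n + 1) H z (t + 1) ω)
      (mem_space_of_reliable hH hopt hω (by omega)) _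
      (mul_pos four_pos (slack_pos hδ0 (by linarith) hτ hm t.succ_pos))
      (fun f hf => excess_le_of_reliable hH hopt hω (by omega) hf)
    have h3 := slack_le (t := t + 1) hδ0 hδ1 hτ hm hN
      (learner_sumProb_mono ℓ δ (n + 1) H z (by omega : t + 1 ≤ n + 1) ω)
    calc _ ≤ _ := h2
      _ ≤ 2 * B * (2 * risk ℓ P hs + 4 * (1 / ((t + 1 : ℕ) : ℝ) * G)) := by gcongr
      _ = _ := by ring
  -- The first round precedes any elimination and is bounded by `1`.
  rw [Finset.sum_range_succ']
  have h4 := Finset.sum_le_sum h1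
  rw [Finset.sum_add_distrib, Finset.sum_const, Finset.card_range, nsmul_eq_mul,
    ← Finset.mul_sum] at h4
  have h5 := sum_one_div_le (τ := n + 1) (by omega)
  rw [Nat.add_sub_cancel] at h5
  have h6 := one_le_lg hδ0 hδ1 hτ hm hN
  have h7 := log_le_lg hδ0 hδ1 hτ hm hN
  have h8 : 8 * B * G * ∑ t ∈ Finset.range n, 1 / ((t + 1 : ℕ) : ℝ) ≤ 8 * B * G * (2 * lg) := by
    gcongr
    linarith
  have h9 := meanProb_le_one (P := P) hℓ (learner ℓ δ (n + 1) H z 0 ω).space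
  have h10 : (n : ℝ) * (4 * B * risk ℓ P hs) ≤
      4 * B * risk ℓ P hs * ((n + 1 : ℕ) : ℝ) := by
    push_cast
    have : 0 ≤ 4 * B * risk ℓ P hs := by positivity
    linarith
  linarith

/-- Unreliability costs `δ / τ`, and the two tails at `x = log (2 τ / δ)` cost `δ / (2 τ)` each. -/
lemma IsSampling.measure_queries_gt_le (hz : IsSampling P μ z)
    (hℓ : ∀ z y, 0 ≤ ℓ z y ∧ ℓ z y ≤ 1) (hδ0 : 0 < δ) (hδ1 : δ < 1 / 2) (hτ : 2 ≤ τ) (hN : 1 ≤ N)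
    {H : Finset (X → Z)} {hs : X → Z} (hH : hs ∈ H)
    (hopt : ∀ g ∈ H, risk ℓ P hs ≤ risk ℓ P g) {θ K : ℝ} (hθ : 0 ≤ θ) (hK : 1 ≤ K)
    (hmean : ∀ V ⊆ H, hs ∈ V → ∀ D > 0, (∀ f ∈ V, risk ℓ P f - risk ℓ P hs ≤ D) →
      meanProb ℓ P V ≤ 2 * (θ * K) * (2 * risk ℓ P hs + D)) :
    μ {ω | 8 * (K * (θ * risk ℓ P hs * τ +
        labelConst θ K * Real.log (τ * H.card * N / δ) ^ 3)) - 1 <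
      (learner ℓ δ τ H z τ ω).queries} ≤ ENNReal.ofReal (2 * δ / τ) := by
  have hm : 1 ≤ H.card := Finset.card_pos.2 ⟨hs, hH⟩
  have hR : 0 ≤ risk ℓ P hs := integral_nonneg fun a => (hℓ _ _).1
  have hτ0 : (0 : ℝ) < τ := by positivity
  set lg := Real.log (τ * H.card * N / δ) with hlg
  set x := Real.log (2 * τ / δ) with hx
  have ex : Real.exp (-x) = δ / (2 * τ) := by
    rw [hx, Real.exp_neg, Real.exp_log (by positivity), inv_div]
  have hxl := log_two_mul_le_lg hδ0 hδ1 hτ hm hN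
  have hsub : {ω | 8 * (K * (θ * risk ℓ P hs * τ + labelConst θ K * lg ^ 3)) - 1 <
      (learner ℓ δ τ H z τ ω).queries} ⊆ (reliable ℓ δ τ H z P hs)ᶜ ∪
      ({ω | 5 / 4 * ∑ t ∈ Finset.range τ, meanProb ℓ P (learner ℓ δ τ H z t ω).space +
        5 / 2 * x ≤ (learner ℓ δ τ H z τ ω).queries} ∪
      {ω | 5 / 4 * ∑ t ∈ Finset.range τ, meanProb ℓ P (learner ℓ δ τ H z t ω).space +
        5 / 2 * x ≤ (learner ℓ δ τ H z τ ω).sumProb}) := by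
    intro ω hω
    by_contra hno
    simp only [Set.mem_union, Set.mem_compl_iff, Set.mem_ofPred_eq, not_or, not_not,
      not_le] at hno hω
    obtain ⟨h1, h2, h3⟩ := hno
    refine absurd (queries_le_of_selfBounding hθ hK hR hτ0.le (one_le_lg hδ0 hδ1 hτ hm hN)
      (learner_sumProb_nonneg ℓ δ τ H z τ ω)
      (sum_meanProb_le hℓ hδ0 hδ1 hτ hN hH hopt (by positivity) hmean h1)
      ?_ ?_) (not_le.2 hω) <;> linarith
  calc _ ≤ _ := measure_mono hsub
    _ ≤ ENNReal.ofReal (δ / τ) + (ENNReal.ofReal (Real.exp (-x)) +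
        ENNReal.ofReal (Real.exp (-x))) := by
        refine (measure_union_le _ _).trans (add_le_add
          (hz.measure_compl_reliable_le hℓ hδ0 (by linarith) hτ hH)
          ((measure_union_le _ _).trans (add_le_add ?_ ?_)))
        · exact hz.tail_queries hℓ δ τ H τ x
        · exact hz.tail_sumProb hℓ δ τ H τ x
    _ = ENNReal.ofReal (2 * δ / τ) := by
        rw [← ENNReal.ofReal_add (Real.exp_pos _).le (Real.exp_pos _).le,
          ← ENNReal.ofReal_add (by positivity) (by positivity), ex]
        congr 1
        field_simp
        norm_num

end LabelComplexity

/-! ### Total expectation over a finite partition -/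

section Conditioning

lemma setIntegral_eq_mul_integral_cond {A : Type*} [MeasurableSpace A] (D : Measure A)
    [IsFiniteMeasure D] (s : Set A) (g : A → ℝ) :
    ∫ a in s, g a ∂D = D.real s * ∫ a, g a ∂(D[|s]) := by
  rw [ProbabilityTheory.cond, integral_smul_measure, ENNReal.toReal_inv, smul_eq_mul,
    ← mul_assoc]
  by_cases h : D s = 0
  · rw [setIntegral_measure_zero _ h, Measure.real, h]; simp
  · rw [Measure.real, mul_inv_cancel₀ (ENNReal.toReal_ne_zero.2 ⟨h, measure_ne_top _ _⟩), one_mul]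

lemma integral_eq_sum_cond {A ι : Type*} [MeasurableSpace A] [Finite A]
    [MeasurableSingletonClass A] [Fintype ι] (D : Measure A) [IsFiniteMeasure D] (f : A → ι)
    (g : A → ℝ) :
    ∫ a, g a ∂D = ∑ i, D.real {a | f a = i} * ∫ a, g a ∂(D[|{a | f a = i}]) := by
  classical
  have h1 : ∀ a, g a = ∑ i, {a | f a = i}.indicator g a := by
    intro a
    rw [Finset.sum_eq_single (f a)]
    · simp
    · intro i _ hi
      exact Set.indicator_of_notMem (by simpa using hi.symm) _
    · simp
  calc ∫ a, g a ∂D = ∫ a, ∑ i, {a | f a = i}.indicator g a ∂D := integral_congr_ae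
        (ae_of_all _ h1)
    _ = ∑ i, ∫ a, {a | f a = i}.indicator g a ∂D :=
        integral_finsetSum _ fun i _ => Integrable.of_finite
    _ = _ := by
        refine Finset.sum_congr rfl fun i _ => ?_
        rw [integral_indicator (Set.toFinite _).measurableSet, setIntegral_eq_mul_integral_cond]

end Conditioning

/-! ### Decomposition of the risk over clusters and samples -/

section Clusters

variable {X Y Z : Type*} [Fintype X] [MeasurableSpace X] [MeasurableSingletonClass X]
  [Fintype Y] [MeasurableSpace Y] [MeasurableSingletonClass Y] {k : ℕ}
  {ℓ : Z → Y → ℝ} {D : Measure (X × Y)} [IsProbabilityMeasure D] {c : X → Fin k}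
  {H : Fin k → Finset (X → Z)}

omit [Fintype X] [MeasurableSingletonClass X] [Fintype Y] [MeasurableSingletonClass Y] in
lemma isProbabilityMeasure_clusterLaw {i : Fin k} (h : D {a | c a.1 = i} ≠ 0) :
    IsProbabilityMeasure (clusterLaw D c i) := cond_isProbabilityMeasure h

omit [IsProbabilityMeasure D] in
lemma ae_clusterLaw (i : Fin k) : ∀ᵐ a ∂clusterLaw D c i, c a.1 = i :=
  ae_cond_mem (Set.toFinite {a : X × Y | c a.1 = i}).measurableSet

lemma risk_eq_sum_clusters (h : X → Z) :
    risk ℓ D h = ∑ i, D.real {a | c a.1 = i} * risk ℓ (clusterLaw D c i) h :=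
  integral_eq_sum_cond D (fun a : X × Y => c a.1) _

omit [IsProbabilityMeasure D] in
lemma risk_clusterLaw_glue (g : Fin k → X → Z) (i : Fin k) :
    risk ℓ (clusterLaw D c i) (glue c g) = risk ℓ (clusterLaw D c i) (g i) := by
  refine integral_congr_ae ?_
  filter_upwards [ae_clusterLaw i] with a ha
  simp [glue, ha]

/-- Exchanging the hypothesis on one cluster stays in the class and changes only that summand of the
risk, whose weight is positive. -/
lemma risk_le_of_optimal (hD : ∀ i, D {a | c a.1 = i} ≠ 0) {G : Fin k → X → Z}
    (hG : ∀ i, G i ∈ H i) (hopt : ∀ h ∈ hypClass c H, risk ℓ D (glue c G) ≤ risk ℓ D h)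
    (i : Fin k) {g : X → Z} (hg : g ∈ H i) :
    risk ℓ (clusterLaw D c i) (G i) ≤ risk ℓ (clusterLaw D c i) g := by
  classical
  have h1 := hopt (glue c (Function.update G i g)) ⟨_, fun j => by
    by_cases hj : j = i
    · subst hj; simpa using hg
    · simpa [hj] using hG j, rfl⟩
  rw [risk_eq_sum_clusters (c := c), risk_eq_sum_clusters (c := c), ← sub_nonneg,
    ← Finset.sum_sub_distrib, Finset.sum_eq_single i] at h1
  · rw [risk_clusterLaw_glue, risk_clusterLaw_glue, Function.update_self, ← mul_sub] at h1
    have h2 : 0 < D.real {a | c a.1 = i} :=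
      ENNReal.toReal_pos (hD i) (measure_ne_top _ _)
    linarith [nonneg_of_mul_nonneg_right h1 h2]
  · intro j _ hj
    rw [risk_clusterLaw_glue, risk_clusterLaw_glue, Function.update_of_ne hj, sub_self]
  · simp

omit [IsProbabilityMeasure D] in
lemma risk_eq_sum_samples (i : Fin k) (h : X → Z) :
    risk ℓ (clusterLaw D c i) h = ∑ x with c x = i,
      sampleRisk ℓ (clusterLaw D c i) h x * sampleProb (clusterLaw D c i) x := by
  classical
  have : IsFiniteMeasure (clusterLaw D c i) := by unfold clusterLaw; infer_instance
  rw [risk, integral_eq_sum_cond (clusterLaw D c i) (fun a : X × Y => a.1), Finset.sum_filter]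
  refine Finset.sum_congr rfl fun x _ => ?_
  split_ifs with hx
  · exact mul_comm _ _
  · have h1 : (clusterLaw D c i) {a | a.1 = x} = 0 := by
      refine measure_mono_null ?_ (ae_clusterLaw (D := D) (c := c) i)
      rintro a rfl
      exact hx
    rw [Measure.real, h1]; simp

omit [MeasurableSingletonClass X] [Fintype Y] [MeasurableSingletonClass Y]
  [IsProbabilityMeasure D] in
lemma one_le_clusterSize (hD : ∀ i, D {a | c a.1 = i} ≠ 0) (i : Fin k) :
    1 ≤ clusterSize c i := by
  obtain ⟨a, ha⟩ := nonempty_of_measure_ne_zero (hD i)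
  exact Finset.card_pos.2 ⟨a.1, by simpa using ha⟩

end Clusters

/-! ### Slope asymmetry and disagreement coefficient -/

section Constants

variable {X Y Z : Type*} [Fintype Y] {ℓ : Z → Y → ℝ} {H : Finset (X → Z)} {B : Set X}

lemma lossDis_le_slopeAsym (hK : slopeAsym ℓ H B ≠ ∞) {f g : X → Z} (hf : f ∈ H) (hg : g ∈ H)
    {x : X} (hx : x ∈ B) (y : Y) :
    lossDis ℓ (f x) (g x) ≤ (slopeAsym ℓ H B).toReal * |ℓ (f x) y - ℓ (g x) y| := by
  have h1 : ENNReal.ofReal (⨆ y : Y, |ℓ (f x) y - ℓ (g x) y|) /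
      ENNReal.ofReal (⨅ y : Y, |ℓ (f x) y - ℓ (g x) y|) ≤ slopeAsym ℓ H B := by
    unfold slopeAsym
    refine le_iSup₂_of_le f hf (le_iSup₂_of_le g hg ?_)
    exact le_iSup₂_of_le x hx (le_iSup₂_of_le (f := fun x' _ =>
      ENNReal.ofReal (⨆ y : Y, |ℓ (f x) y - ℓ (g x') y|) /
        ENNReal.ofReal (⨅ y : Y, |ℓ (f x) y - ℓ (g x') y|)) x hx le_rfl)
  rw [ENNReal.div_le_iff_le_mul (Or.inr hK) (Or.inl ENNReal.ofReal_ne_top)] at h1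
  have h2 : (⨅ y : Y, |ℓ (f x) y - ℓ (g x) y|) ≤ |ℓ (f x) y - ℓ (g x) y| :=
    ciInf_le (Set.finite_range _).bddBelow y
  have h3 := ENNReal.toReal_mono (ENNReal.mul_ne_top hK ENNReal.ofReal_ne_top) h1
  rw [ENNReal.toReal_mul, ENNReal.toReal_ofReal (Real.iSup_nonneg fun _ => abs_nonneg _),
    ENNReal.toReal_ofReal (Real.iInf_nonneg fun _ => abs_nonneg _)] at h3
  exact h3.trans (by gcongr)

/-- Since `0/0 = 0`, the asymmetry may vanish, but every nonzero ratio of a maximum to a minimum is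
at least `1`. The value `0` needs separate treatment. -/
lemma one_le_slopeAsym [Nonempty Y] (hK : slopeAsym ℓ H B ≠ 0) : 1 ≤ slopeAsym ℓ H B := by
  by_contra h
  refine hK ?_
  unfold slopeAsym at h ⊢
  simp only [ENNReal.iSup_eq_zero]
  intro f hf g hg x hx x' hx'
  by_contra hne
  refine h (le_trans ?_ (le_trans (le_iSup₂_of_le x hx (le_iSup₂_of_le x' hx' le_rfl))
      (le_iSup₂_of_le f hf (le_iSup₂_of_le g hg le_rfl))))
  obtain ⟨y⟩ := ‹Nonempty Y›
  have h1 : (⨅ y : Y, |ℓ (f x) y - ℓ (g x') y|) ≤ ⨆ y : Y, |ℓ (f x) y - ℓ (g x') y| :=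
    (ciInf_le (Set.finite_range _).bddBelow y).trans
      (le_ciSup (f := fun y => |ℓ (f x) y - ℓ (g x') y|) (Set.finite_range _).bddAbove y)
  have h2 : ENNReal.ofReal (⨆ y : Y, |ℓ (f x) y - ℓ (g x') y|) ≠ 0 := by
    intro h0
    rw [h0, ENNReal.zero_div] at hne
    exact hne rfl
  calc 1 = ENNReal.ofReal (⨆ y : Y, |ℓ (f x) y - ℓ (g x') y|) /
        ENNReal.ofReal (⨆ y : Y, |ℓ (f x) y - ℓ (g x') y|) :=
        (ENNReal.div_self h2 ENNReal.ofReal_ne_top).symm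
    _ ≤ _ := ENNReal.div_le_div_left (ENNReal.ofReal_le_ofReal h1) _

variable [Fintype X] [MeasurableSpace X] [MeasurableSingletonClass X]
  [MeasurableSpace Y] [MeasurableSingletonClass Y] {P : Measure (X × Y)} {hstar : X → Z}

omit [Fintype X] [MeasurableSingletonClass X] [Fintype Y] [MeasurableSingletonClass Y] in
lemma iSup_hypBall_nonneg (r : ℝ) (x : X) :
    0 ≤ ⨆ h : hypBall ℓ P H hstar r, lossDis ℓ (h.1 x) (hstar x) :=
  Real.iSup_nonneg fun _ => lossDis_nonneg _ _

omit [Fintype X] [MeasurableSingletonClass X] [Fintype Y] [MeasurableSingletonClass Y] in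
lemma lossDis_le_iSup_hypBall {r : ℝ} {f : X → Z} (hf : f ∈ hypBall ℓ P H hstar r) (x : X) :
    lossDis ℓ (f x) (hstar x) ≤
      ⨆ h : hypBall ℓ P H hstar r, lossDis ℓ (h.1 x) (hstar x) := by
  have : Finite (hypBall ℓ P H hstar r) :=
    (H.finite_toSet.subset fun h hh => hh.1 : (hypBall ℓ P H hstar r).Finite)
  exact le_ciSup (f := fun h : hypBall ℓ P H hstar r => lossDis ℓ (h.1 x) (hstar x))
    (Set.finite_range _).bddAbove ⟨f, hf⟩

/-- Bounds the quotients in `disCoeff` by `H.card`. Without a bound the real supremum would take its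
default value `0` and dominate nothing. -/
lemma integral_iSup_hypBall_le [IsFiniteMeasure P] {r : ℝ} (hr : 0 < r) :
    ∫ a, (⨆ h : hypBall ℓ P H hstar r, lossDis ℓ (h.1 a.1) (hstar a.1)) ∂P ≤ H.card * r := by
  classical
  calc _ ≤ ∫ a, ∑ h ∈ H with hypDist ℓ P h hstar ≤ r, lossDis ℓ (h a.1) (hstar a.1) ∂P := by
        refine integral_mono Integrable.of_finite Integrable.of_finite fun a => ?_
        refine Real.iSup_le (fun h => ?_) (Finset.sum_nonneg fun _ _ => lossDis_nonneg _ _)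
        exact Finset.single_le_sum (f := fun h : X → Z => lossDis ℓ (h a.1) (hstar a.1))
          (fun _ _ => lossDis_nonneg _ _) (Finset.mem_filter.2 h.2)
    _ = ∑ h ∈ H with hypDist ℓ P h hstar ≤ r, hypDist ℓ P h hstar :=
        integral_finsetSum _ fun _ _ => Integrable.of_finite
    _ ≤ ∑ h ∈ H with hypDist ℓ P h hstar ≤ r, r :=
        Finset.sum_le_sum fun h hh => (Finset.mem_filter.1 hh).2
    _ ≤ H.card * r := by
        rw [Finset.sum_const, nsmul_eq_mul]
        gcongr
        exact Finset.filter_subset _ _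

lemma integral_iSup_hypBall_le_disCoeff [IsFiniteMeasure P] {r : ℝ} (hr : 0 < r) :
    ∫ a, (⨆ h : hypBall ℓ P H hstar r, lossDis ℓ (h.1 a.1) (hstar a.1)) ∂P ≤
      disCoeff ℓ P H hstar * r := by
  rw [← div_le_iff₀ hr]
  refine le_ciSup (f := fun r : Set.Ioi (0 : ℝ) =>
    (∫ a, (⨆ h : hypBall ℓ P H hstar r, lossDis ℓ (h.1 a.1) (hstar a.1)) ∂P) / (r : ℝ))
    ⟨H.card, ?_⟩ ⟨r, hr⟩
  rintro _ ⟨⟨s, hs⟩, rfl⟩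
  exact (div_le_iff₀ hs).2 (integral_iSup_hypBall_le hs)

omit [Fintype X] [MeasurableSingletonClass X] [Fintype Y] [MeasurableSingletonClass Y] in
lemma disCoeff_nonneg : 0 ≤ disCoeff ℓ P H hstar :=
  Real.iSup_nonneg fun r =>
    div_nonneg (integral_nonneg fun _ => iSup_hypBall_nonneg _ _) (le_of_lt r.2)

/-- The disagreement coefficient and the slope asymmetry bound the expected query probability of
a version space of small excess risk. -/
lemma meanProb_le_of_excess [IsProbabilityMeasure P] (hℓ : ∀ z y, 0 ≤ ℓ z y ∧ ℓ z y ≤ 1)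
    (hPB : ∀ᵐ a ∂P, a.1 ∈ B) {hs : X → Z} (hH : hs ∈ H) (heq : ∀ x ∈ B, hs x = hstar x)
    (hK : slopeAsym ℓ H B ≠ ∞) (hK1 : 1 ≤ (slopeAsym ℓ H B).toReal) {V : Finset (X → Z)}
    (hV : V ⊆ H) {d : ℝ} (hd : 0 < d) (hVd : ∀ f ∈ V, risk ℓ P f - risk ℓ P hs ≤ d) :
    meanProb ℓ P V ≤
      2 * (disCoeff ℓ P H hstar * (slopeAsym ℓ H B).toReal) * (2 * risk ℓ P hs + d) := by
  set K := (slopeAsym ℓ H B).toReal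
  have hR : 0 ≤ risk ℓ P hs := integral_nonneg fun a => (hℓ _ _).1
  have hr : 0 < K * (2 * risk ℓ P hs + d) := by positivity
  -- The asymmetry replaces the maximum over labels by the label drawn, at the price `K`; there the
  -- loss difference is at most the sum of the two losses, with mean `risk f + risk hs`.
  have hball : ∀ f ∈ V, f ∈ hypBall ℓ P H hstar (K * (2 * risk ℓ P hs + d)) := by
    refine fun f hf => ⟨hV hf, ?_⟩
    calc hypDist ℓ P f hstar ≤ ∫ a, K * (ℓ (f a.1) a.2 + ℓ (hs a.1) a.2) ∂P := by
          refine integral_mono_ae Integrable.of_finite Integrable.of_finite ?_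
          filter_upwards [hPB] with a ha
          have h1 := lossDis_le_slopeAsym hK (hV hf) hH ha a.2
          rw [heq _ ha] at h1
          refine h1.trans (mul_le_mul_of_nonneg_left ?_ (by positivity))
          rw [← heq _ ha, abs_le]
          constructor <;> linarith [hℓ (f a.1) a.2, hℓ (hs a.1) a.2]
      _ = K * (risk ℓ P f + risk ℓ P hs) := by
          rw [integral_const_mul, integral_add Integrable.of_finite Integrable.of_finite]
          rfl
      _ ≤ K * (2 * risk ℓ P hs + d) :=
          mul_le_mul_of_nonneg_left (by linarith [hVd f hf]) (by positivity)
  calc meanProb ℓ P V ≤ ∫ a, 2 * (⨆ h : hypBall ℓ P H hstar (K * (2 * risk ℓ P hs + d)),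
        lossDis ℓ (h.1 a.1) (hstar a.1)) ∂P := by
        refine integral_mono Integrable.of_finite Integrable.of_finite fun a => ?_
        refine Real.iSup_le (fun q => ?_) (mul_nonneg two_pos.le (iSup_hypBall_nonneg _ _))
        refine (lossDis_triangle _ (hstar a.1) _).trans ?_
        rw [two_mul, lossDis_comm (hstar a.1)]
        exact add_le_add (lossDis_le_iSup_hypBall (hball _ q.1.2) _)
          (lossDis_le_iSup_hypBall (hball _ q.2.2) _)
    _ ≤ 2 * (disCoeff ℓ P H hstar * (K * (2 * risk ℓ P hs + d))) := by
        rw [integral_const_mul]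
        gcongr
        exact integral_iSup_hypBall_le_disCoeff hr
    _ = _ := by ring

end Constants

/-! ### Clusters of vanishing slope asymmetry -/

section NoQueries

variable {X Y Z Ω : Type*} [Fintype X] [MeasurableSpace X] [MeasurableSingletonClass X]
  [Fintype Y] [MeasurableSpace Y] [MeasurableSingletonClass Y] [MeasurableSpace Ω]
  {P : Measure (X × Y)} [IsProbabilityMeasure P] {μ : Measure Ω}
  {z : ℕ → Ω → (X × Y) × ℝ} {ℓ : Z → Y → ℝ} {H : Finset (X → Z)} {B : Set X}

omit [Fintype X] [MeasurableSingletonClass X] [Fintype Y] [MeasurableSingletonClass Y]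
  [IsProbabilityMeasure P] in
lemma IsSampling.ae_mem (hz : IsSampling P μ z) (hPB : ∀ᵐ a ∂P, a.1 ∈ B) (t : ℕ) :
    ∀ᵐ ω ∂μ, (z t ω).1.1 ∈ B ∧ 0 ≤ (z t ω).2 := by
  refine ae_of_ae_map (p := fun w => w.1.1 ∈ B ∧ 0 ≤ w.2) (hz.measurable t).aemeasurable ?_
  rw [hz.law t, coinLaw]
  have h1 : ∀ᵐ u ∂(volume.restrict (Set.Icc (0 : ℝ) 1)), u ∈ Set.Icc (0 : ℝ) 1 :=
    ae_restrict_mem measurableSet_Icc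
  filter_upwards [Measure.quasiMeasurePreserving_fst.ae hPB,
    Measure.quasiMeasurePreserving_snd.ae h1] with w hw1 hw2
  exact ⟨hw1, hw2.1⟩

omit [Fintype X] [MeasurableSingletonClass X] [MeasurableSingletonClass Y]
  [IsProbabilityMeasure P] in
-- All predictions at a sample of `B` then have equal losses, so the query probability is `0`, and
-- the coin is almost surely not below it.
lemma IsSampling.ae_queries_eq_zero (hz : IsSampling P μ z) (hPB : ∀ᵐ a ∂P, a.1 ∈ B)
    (hK : slopeAsym ℓ H B = 0) [Nonempty Y] (δ : ℝ) (τ : ℕ) :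
    ∀ᵐ ω ∂μ, (learner ℓ δ τ H z τ ω).queries = 0 := by
  filter_upwards [ae_all_iff.2 (hz.ae_mem hPB)] with ω hω
  rw [learner_queries]
  refine Finset.sum_eq_zero fun t _ => ?_
  have h1 : queryProb ℓ (learner ℓ δ τ H z t ω).space (z t ω).1.1 ≤ 0 := by
    refine Real.iSup_le (fun q => ?_) le_rfl
    obtain ⟨y⟩ := ‹Nonempty Y›
    have := lossDis_le_slopeAsym (by rw [hK]; exact ENNReal.zero_ne_top)
      (learner_space_subset ℓ δ τ H z t ω q.1.2) (learner_space_subset ℓ δ τ H z t ω q.2.2)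
      (hω t).1 y
    simpa [hK] using this
  rw [roundCoin, coin, if_neg (not_lt.2 (h1.trans (hω t).2))]

end NoQueries

/-! ### Combining dependent events -/

section Events

variable {Ω : Type*} [MeasurableSpace Ω] {μ : Measure Ω} [IsProbabilityMeasure μ]

/-- Only subadditivity is used, so `s` need not be measurable. -/
lemma one_sub_le_measureReal {s : Set Ω} {ε : ℝ} (hε : 0 ≤ ε) (h : μ sᶜ ≤ ENNReal.ofReal ε) :
    1 - ε ≤ μ.real s := by
  have h1 : μ.real Set.univ ≤ μ.real s + μ.real sᶜ := by
    rw [← Set.union_compl_self s]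
    exact measureReal_union_le _ _
  have h2 : μ.real sᶜ ≤ ε := ENNReal.toReal_le_of_le_ofReal hε h
  rw [probReal_univ] at h1
  linarith

omit [IsProbabilityMeasure μ] in
/-- Among `k` possibly dependent events of probability at most `ε / τ`, at least the fraction
`1 / τ` happens with probability at most `ε`. -/
lemma measure_card_le_sum_indicator_le {k τ : ℕ} (hk : 0 < k) (hτ : 0 < τ) {ε : ℝ}
    {F : Fin k → Set Ω} (hF : ∀ i, MeasurableSet (F i))
    (hμ : ∀ i, μ (F i) ≤ ENNReal.ofReal (ε / τ)) :
    μ {ω | (k : ℝ≥0∞) ≤ ∑ i, (F i).indicator (fun _ => (τ : ℝ≥0∞)) ω} ≤ ENNReal.ofReal ε := by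
  have h1 := mul_meas_ge_le_lintegral (μ := μ) (Finset.measurable_sum (Finset.univ : Finset (Fin k))
    fun i _ => (measurable_const (a := (τ : ℝ≥0∞))).indicator (hF i)) (k : ℝ≥0∞)
  have h2 : ∫⁻ ω, ∑ i, (F i).indicator (fun _ => (τ : ℝ≥0∞)) ω ∂μ ≤ k * ENNReal.ofReal ε := by
    rw [lintegral_finsetSum _ fun i _ => measurable_const.indicator (hF i)]
    calc _ ≤ ∑ _i : Fin k, ENNReal.ofReal ε := by
          refine Finset.sum_le_sum fun i _ => ?_
          rw [lintegral_indicator_const (hF i)]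
          calc _ ≤ (τ : ℝ≥0∞) * ENNReal.ofReal (ε / τ) := by gcongr; exact hμ i
            _ = ENNReal.ofReal ε := by
                rw [← ENNReal.ofReal_natCast, ← ENNReal.ofReal_mul (Nat.cast_nonneg _),
                  mul_div_cancel₀]
                positivity
      _ = _ := by simp
  have h3 : (k : ℝ≥0∞) ≠ 0 := by exact_mod_cast hk.ne'
  exact (ENNReal.mul_le_mul_iff_right h3 (ENNReal.natCast_ne_top k)).1 (h1.trans h2)

end Events

/-! ### Measurable versions of the draws -/

section Modification

variable {X Y Z Ω : Type*} [MeasurableSpace X] [MeasurableSpace Y] [MeasurableSpace Ω]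
  {μ : Measure Ω}

lemma exists_isSampling {P : Measure (X × Y)} {z : ℕ → Ω → (X × Y) × ℝ}
    (hlaw : ∀ t, HasLaw (z t) (coinLaw P) μ) (hi : iIndepFun z μ) :
    ∃ z', IsSampling P μ z' ∧ ∀ᵐ ω ∂μ, ∀ t, z t ω = z' t ω := by
  refine ⟨fun t => (hlaw t).aemeasurable.mk (z t),
    ⟨fun t => (hlaw t).aemeasurable.measurable_mk,
      hi.congr fun t => (hlaw t).aemeasurable.ae_eq_mk, fun t => ?_⟩,
    ae_all_iff.2 fun t => (hlaw t).aemeasurable.ae_eq_mk⟩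
  rw [← Measure.map_congr (hlaw t).aemeasurable.ae_eq_mk, (hlaw t).map_eq]

end Modification

/-! ### Combining the clusters -/

section Main

variable {X Y Z Ω : Type*} [Fintype X] [MeasurableSpace X] [MeasurableSingletonClass X]
  [Fintype Y] [MeasurableSpace Y] [MeasurableSingletonClass Y] [MeasurableSpace Ω]
  {ℓ : Z → Y → ℝ} {D : Measure (X × Y)} [IsProbabilityMeasure D] {k : ℕ} {c : X → Fin k}
  {H : Fin k → Finset (X → Z)} {G : Fin k → X → Z} {τ : ℕ} {δ : ℝ} {μ : Measure Ω}
  [IsProbabilityMeasure μ] {z : Fin k → ℕ → Ω → (X × Y) × ℝ}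

lemma sum_measureReal_cluster : ∑ i, D.real {a | c a.1 = i} = 1 := by
  have h := integral_eq_sum_cond D (fun a : X × Y => c a.1) fun _ => 1
  rw [integral_const, probReal_univ, one_smul] at h
  rw [h]
  refine Finset.sum_congr rfl fun i _ => ?_
  by_cases h0 : D {a | c a.1 = i} = 0
  · simp [Measure.real, h0]
  · have := cond_isProbabilityMeasure h0
    simp

lemma risk_le_one (hℓ : ∀ z y, 0 ≤ ℓ z y ∧ ℓ z y ≤ 1) (h : X → Z) : risk ℓ D h ≤ 1 := by
  have : risk ℓ D h ≤ ∫ _a, (1 : ℝ) ∂D :=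
    integral_mono Integrable.of_finite Integrable.of_finite fun a => (hℓ _ _).2
  simpa using this

/-- The excess risk of the glued hypothesis is at most the largest excess risk of a cluster. -/
lemma risk_glue_sub_le {g : Fin k → X → Z} {M : ℝ}
    (h : ∀ i, risk ℓ (clusterLaw D c i) (g i) - risk ℓ (clusterLaw D c i) (G i) ≤ M) :
    risk ℓ D (glue c g) - risk ℓ D (glue c G) ≤ M := by
  rw [risk_eq_sum_clusters (c := c), risk_eq_sum_clusters (c := c), ← Finset.sum_sub_distrib]
  calc _ ≤ ∑ i, D.real {a | c a.1 = i} * M := by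
        refine Finset.sum_le_sum fun i _ => ?_
        rw [risk_clusterLaw_glue, risk_clusterLaw_glue, ← mul_sub]
        exact mul_le_mul_of_nonneg_left (h i) measureReal_nonneg
    _ = M := by rw [← Finset.sum_mul, sum_measureReal_cluster, one_mul]

/-- The bound on the excess risk of a cluster with state `s`. -/
noncomputable def excessBound (δ : ℝ) (τ m : ℕ) (S : ℝ) : ℝ :=
  2 / τ * (√S + 6 * √(Real.log (2 * (3 + τ) * τ ^ 2 / δ))) *
    √(Real.log (16 * τ ^ 2 * m ^ 2 * Real.log τ / δ))

lemma two_mul_slack_eq (δ : ℝ) (τ m : ℕ) (S : ℝ) :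
    2 * slack δ τ m τ S = excessBound δ τ m S := by
  unfold slack excessBound; ring

lemma excessBound_nonneg (δ : ℝ) (τ m : ℕ) (S : ℝ) : 0 ≤ excessBound δ τ m S := by
  unfold excessBound; positivity

lemma one_div_le_excessBound (hδ0 : 0 < δ) (hδ1 : δ ≤ 1) (hτ : 2 ≤ τ) {m : ℕ} (hm : 1 ≤ m)
    (S : ℝ) : 1 / (τ : ℝ) ≤ excessBound δ τ m S := by
  have h1 := one_le_log_two_mul hδ0 hδ1 hτ
  have h2 := log_two_mul_le_left hδ0 hτ
  have h3 := log_two_mul_le_right hδ0 hτ hm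
  have h4 : 1 ≤ √(Real.log (2 * (3 + τ) * τ ^ 2 / δ)) := Real.one_le_sqrt.2 (by linarith)
  have h5 : 1 ≤ √(Real.log (16 * τ ^ 2 * m ^ 2 * Real.log τ / δ)) :=
    Real.one_le_sqrt.2 (by linarith)
  unfold excessBound
  calc 1 / (τ : ℝ) ≤ 2 / τ * (0 + 6 * 1) * 1 := by
        rw [div_mul_eq_mul_div, mul_one]
        gcongr
        norm_num
    _ ≤ _ := by gcongr; exact Real.sqrt_nonneg S

/-- The glued excess is an average of cluster excesses, so for `k ≤ τ` the factor `k` is not needed.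
For `τ < k` each cluster bound is at least `1 / τ`, and the factor `k` makes the claim trivial. -/
theorem excess_risk_bound (hℓ : ∀ z y, 0 ≤ ℓ z y ∧ ℓ z y ≤ 1) (hD : ∀ i, D {a | c a.1 = i} ≠ 0)
    (hG : ∀ i, G i ∈ H i) (hopt : ∀ h ∈ hypClass c H, risk ℓ D (glue c G) ≤ risk ℓ D h)
    (hτ : 2 ≤ τ) (hδ : 0 < δ) (hz : ∀ i, IsSampling (clusterLaw D c i) μ (z i)) :
    μ {ω | ∀ g : Fin k → X → Z, (∀ i, g i ∈ (learner ℓ δ τ (H i) (z i) τ ω).outputs) →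
        risk ℓ D (glue c g) - risk ℓ D (glue c G) ≤
          k * ⨆ i, excessBound δ τ (H i).card (learner ℓ δ τ (H i) (z i) τ ω).sumProb}ᶜ ≤
      ENNReal.ofReal δ := by
  rcases lt_or_ge 1 δ with hδ1 | hδ1
  · exact prob_le_one.trans (by simpa using ENNReal.ofReal_le_ofReal hδ1.le)
  have hP := fun i => isProbabilityMeasure_clusterLaw (hD i)
  have hτ0 : (0 : ℝ) < τ := by positivity
  have hne : Nonempty (Fin k) := by
    obtain ⟨a⟩ := D.nonempty_of_neZero
    exact ⟨c a.1⟩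
  have hk : 1 ≤ k := Fin.pos_iff_nonempty.2 hne
  have hk1 : (1 : ℝ) ≤ k := by exact_mod_cast hk
  have hsup : ∀ ω i, excessBound δ τ (H i).card (learner ℓ δ τ (H i) (z i) τ ω).sumProb ≤
      ⨆ i, excessBound δ τ (H i).card (learner ℓ δ τ (H i) (z i) τ ω).sumProb := fun ω i =>
    le_ciSup (f := fun i => excessBound δ τ (H i).card (learner ℓ δ τ (H i) (z i) τ ω).sumProb)
      (Set.finite_range _).bddAbove i
  have hm : ∀ i, 1 ≤ (H i).card := fun i => Finset.card_pos.2 ⟨_, hG i⟩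
  rcases lt_or_ge τ k with hkτ | hkτ
  · refine le_of_eq_of_le (measure_mono_null (t := ∅) (fun ω hω => (hω fun g _ => ?_).elim)
      measure_empty) zero_le
    obtain ⟨i⟩ := hne
    have h1 := (one_div_le_excessBound hδ hδ1 hτ (hm i) _).trans (hsup ω i)
    have h2 : 1 ≤ (k : ℝ) * (1 / τ) := by
      rw [mul_one_div, one_le_div hτ0]
      exact_mod_cast hkτ.le
    have h3 : 0 ≤ risk ℓ D (glue c G) := integral_nonneg fun a => (hℓ _ _).1
    have h4 := mul_le_mul_of_nonneg_left h1 (Nat.cast_nonneg (α := ℝ) k)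
    linarith [risk_le_one (D := D) hℓ (glue c g)]
  · calc _ ≤ μ (⋃ i, (reliable ℓ δ τ (H i) (z i) (clusterLaw D c i) (G i))ᶜ) := by
          refine measure_mono fun ω hω => ?_
          by_contra hno
          simp only [Set.mem_iUnion, Set.mem_compl_iff, not_exists, not_not] at hno
          refine hω fun g hg => risk_glue_sub_le fun i => ?_
          have h1 := excess_output_le_of_reliable (by omega) (hG i)
            (fun f hf => risk_le_of_optimal hD hG hopt i hf) (hno i) (hg i)
          rw [two_mul_slack_eq] at h1
          have h2 : 0 ≤ ⨆ i, excessBound δ τ (H i).card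
              (learner ℓ δ τ (H i) (z i) τ ω).sumProb :=
            Real.iSup_nonneg fun i => excessBound_nonneg _ _ _ _
          exact (h1.trans (hsup ω i)).trans (le_mul_of_one_le_left h2 hk1)
      _ ≤ ∑ i, μ (reliable ℓ δ τ (H i) (z i) (clusterLaw D c i) (G i))ᶜ :=
          measure_iUnion_fintype_le _ _
      _ ≤ ∑ _i : Fin k, ENNReal.ofReal (δ / τ) :=
          Finset.sum_le_sum fun i _ =>
            (hz i).measure_compl_reliable_le hℓ hδ hδ1 hτ (hG i)
      _ = ENNReal.ofReal (k * (δ / τ)) := by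
          rw [ENNReal.ofReal_mul (Nat.cast_nonneg _)]; simp
      _ ≤ ENNReal.ofReal δ := by
          refine ENNReal.ofReal_le_ofReal ?_
          rw [mul_div_assoc', div_le_iff₀ hτ0, mul_comm]
          gcongr

/-- The bound on the label complexity of cluster `i`, up to the factor `8`. -/
noncomputable def labelBound (ℓ : Z → Y → ℝ) (D : Measure (X × Y)) (c : X → Fin k)
    (H : Fin k → Finset (X → Z)) (hstar : X → Z) (τ : ℕ) (δ : ℝ) (i : Fin k) : ℝ :=
  (slopeAsym ℓ (H i) {x | c x = i}).toReal *
    (∑ x with c x = i, disCoeff ℓ (clusterLaw D c i) (H i) hstar *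
        sampleRisk ℓ (clusterLaw D c i) hstar x * τ * sampleProb (clusterLaw D c i) x
      + ∑ x with c x = i, labelConst (disCoeff ℓ (clusterLaw D c i) (H i) hstar)
          (slopeAsym ℓ (H i) {x | c x = i}).toReal *
          √(sampleRisk ℓ (clusterLaw D c i) hstar x * τ * sampleProb (clusterLaw D c i) x *
            Real.log (τ * (H i).card * clusterSize c i / δ))
      + labelConst (disCoeff ℓ (clusterLaw D c i) (H i) hstar)
          (slopeAsym ℓ (H i) {x | c x = i}).toReal *
        (clusterSize c i * Real.log (τ * (H i).card * clusterSize c i / δ) ^ 3))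

lemma labelConst_nonneg (θ K : ℝ) : 0 ≤ labelConst θ K := by unfold labelConst; positivity

omit [IsProbabilityMeasure D] in
-- The cluster bound uses only the linear and the cubic logarithmic term. The square roots are
-- nonnegative, and `N_i ≥ 1`.
lemma le_labelBound (hD : ∀ i, D {a | c a.1 = i} ≠ 0) {hstar : X → Z} {i : Fin k}
    (hlg : 0 ≤ Real.log (τ * (H i).card * clusterSize c i / δ)) :
    (slopeAsym ℓ (H i) {x | c x = i}).toReal *
      (disCoeff ℓ (clusterLaw D c i) (H i) hstar * risk ℓ (clusterLaw D c i) hstar * τ +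
        labelConst (disCoeff ℓ (clusterLaw D c i) (H i) hstar)
          (slopeAsym ℓ (H i) {x | c x = i}).toReal *
          Real.log (τ * (H i).card * clusterSize c i / δ) ^ 3) ≤
      labelBound ℓ D c H hstar τ δ i := by
  have hN : (1 : ℝ) ≤ clusterSize c i := by exact_mod_cast one_le_clusterSize hD i
  have e : disCoeff ℓ (clusterLaw D c i) (H i) hstar * risk ℓ (clusterLaw D c i) hstar * τ =
      ∑ x with c x = i, disCoeff ℓ (clusterLaw D c i) (H i) hstar *
        sampleRisk ℓ (clusterLaw D c i) hstar x * τ * sampleProb (clusterLaw D c i) x := by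
    rw [risk_eq_sum_samples, Finset.mul_sum, Finset.sum_mul]
    exact Finset.sum_congr rfl fun x _ => by ring
  have hC := labelConst_nonneg (disCoeff ℓ (clusterLaw D c i) (H i) hstar)
    (slopeAsym ℓ (H i) {x | c x = i}).toReal
  unfold labelBound
  rw [e]
  refine mul_le_mul_of_nonneg_left (add_le_add ?_ ?_) ENNReal.toReal_nonneg
  · exact le_add_of_nonneg_right (Finset.sum_nonneg fun x _ =>
      mul_nonneg hC (Real.sqrt_nonneg _))
  · refine mul_le_mul_of_nonneg_left ?_ hC
    exact le_mul_of_one_le_left (by positivity) hN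

/-- A plain union bound over clusters fails when `k` exceeds `τ`. Instead, a cluster is bad if it
asks for more than `8 M - 1` labels, with `M` the largest cluster bound, and Markov's inequality
controls the number of bad clusters. -/
theorem label_complexity_bound (hℓ : ∀ z y, 0 ≤ ℓ z y ∧ ℓ z y ≤ 1)
    (hD : ∀ i, D {a | c a.1 = i} ≠ 0) (hG : ∀ i, G i ∈ H i)
    (hopt : ∀ h ∈ hypClass c H, risk ℓ D (glue c G) ≤ risk ℓ D h)
    (hτ : 2 ≤ τ) (hδ : 0 < δ) (hz : ∀ i, IsSampling (clusterLaw D c i) μ (z i))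
    (hK : ∀ i, slopeAsym ℓ (H i) {x | c x = i} ≠ ∞) :
    μ {ω | ((∑ i, (learner ℓ δ τ (H i) (z i) τ ω).queries : ℕ) : ℝ) ≤
      8 * k * ⨆ i, labelBound ℓ D c H (glue c G) τ δ i}ᶜ ≤ ENNReal.ofReal (2 * δ) := by
  rcases le_or_gt (1 / 2) δ with hδ1 | hδ1
  · exact prob_le_one.trans (by simpa using ENNReal.ofReal_le_ofReal (by linarith : 1 ≤ 2 * δ))
  have hP := fun i => isProbabilityMeasure_clusterLaw (hD i)
  have hτ0 : (0 : ℝ) < τ := by positivity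
  obtain ⟨a⟩ := D.nonempty_of_neZero
  have hY : Nonempty Y := ⟨a.2⟩
  have hk : 0 < k := Fin.pos_iff_nonempty.2 ⟨c a.1⟩
  have hm : ∀ i, 1 ≤ (H i).card := fun i => Finset.card_pos.2 ⟨_, hG i⟩
  have hN := one_le_clusterSize (D := D) (c := c) hD
  have hlg := fun i => one_le_lg hδ hδ1 hτ (hm i) (hN i)
  have hPB : ∀ i, ∀ᵐ a ∂clusterLaw D c i, a.1 ∈ {x | c x = i} := fun i => ae_clusterLaw i
  have heq : ∀ i, ∀ x ∈ {x | c x = i}, G i x = glue c G x := by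
    rintro i x rfl; rfl
  have hrisk : ∀ i, risk ℓ (clusterLaw D c i) (G i) = risk ℓ (clusterLaw D c i) (glue c G) :=
    fun i => (risk_clusterLaw_glue G i).symm
  set L := labelBound ℓ D c H (glue c G) τ δ with hL
  have hL0 : ∀ i, slopeAsym ℓ (H i) {x | c x = i} ≠ 0 → 1 ≤ L i := by
    intro i hi
    refine le_trans ?_ (le_labelBound hD (by linarith [hlg i]))
    have hK1 : 1 ≤ (slopeAsym ℓ (H i) {x | c x = i}).toReal := by
      simpa using ENNReal.toReal_mono (hK i) (one_le_slopeAsym hi)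
    set K := (slopeAsym ℓ (H i) {x | c x = i}).toReal
    have hθ : 0 ≤ disCoeff ℓ (clusterLaw D c i) (H i) (glue c G) := disCoeff_nonneg
    set θ := disCoeff ℓ (clusterLaw D c i) (H i) (glue c G)
    have hR : 0 ≤ risk ℓ (clusterLaw D c i) (glue c G) := integral_nonneg fun a => (hℓ _ _).1
    have hC : 1 ≤ labelConst θ K := by
      unfold labelConst
      have h1 : 1 ≤ (1 + θ) ^ 2 := one_le_pow₀ (by linarith)
      have h2 : 1 ≤ (1 + K) ^ 2 := one_le_pow₀ (by linarith)
      nlinarith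
    have hl3 := one_le_pow₀ (n := 3) (hlg i)
    have h1 := one_le_mul_of_one_le_of_one_le hC hl3
    have h2 : 0 ≤ θ * risk ℓ (clusterLaw D c i) (glue c G) * τ := by positivity
    exact one_le_mul_of_one_le_of_one_le hK1 (by linarith)
  have hsup : ∀ i, L i ≤ ⨆ i, L i := fun i => le_ciSup (Set.finite_range _).bddAbove i
  -- If all asymmetries vanish, both sides are almost surely `0`. Otherwise `1 ≤ M`, so `8 M - 1` is
  -- positive and a cluster without queries is not bad.
  by_cases hall : ∀ i, slopeAsym ℓ (H i) {x | c x = i} = 0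
  · refine le_of_eq_of_le (measure_mono_null (t := {ω | ¬ ∀ i,
      (learner ℓ δ τ (H i) (z i) τ ω).queries = 0}) ?_ ?_) zero_le
    · intro ω hω h0
      refine hω ?_
      have h1 : ∑ i, (learner ℓ δ τ (H i) (z i) τ ω).queries = 0 :=
        Finset.sum_eq_zero fun i _ => h0 i
      have h2 : ∀ i, L i = 0 := fun i => by simp [hL, labelBound, hall i]
      simp only [Set.mem_ofPred_eq, h1]
      simp [h2]
    · exact ae_all_iff.2 fun i => (hz i).ae_queries_eq_zero (hPB i) (hall i) δ τ
  push Not at hall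
  obtain ⟨i₀, hi₀⟩ := hall
  have hM : 1 ≤ ⨆ i, L i := (hL0 i₀ hi₀).trans (hsup i₀)
  set M := ⨆ i, L i with hMdef
  let F : Fin k → Set Ω := fun i => {ω | 8 * M - 1 < (learner ℓ δ τ (H i) (z i) τ ω).queries}
  have hF : ∀ i, MeasurableSet (F i) := fun i =>
    past_le (hz i).measurable τ _ ((isRecursion_learner ℓ δ τ (H i) (z i)).measurableSet_preimage
      τ {s | 8 * M - 1 < s.queries})
  have hμF : ∀ i, μ (F i) ≤ ENNReal.ofReal (2 * δ / τ) := by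
    intro i
    by_cases hi : slopeAsym ℓ (H i) {x | c x = i} = 0
    · refine le_of_eq_of_le (measure_mono_null (t := {ω | ¬
        (learner ℓ δ τ (H i) (z i) τ ω).queries = 0}) ?_
        ((hz i).ae_queries_eq_zero (hPB i) hi δ τ)) zero_le
      intro ω hω h0
      simp only [F, Set.mem_ofPred_eq, h0, Nat.cast_zero] at hω
      linarith
    · have hK1 : 1 ≤ (slopeAsym ℓ (H i) {x | c x = i}).toReal := by
        simpa using ENNReal.toReal_mono (hK i) (one_le_slopeAsym hi)
      refine (measure_mono fun ω hω => ?_).trans ((hz i).measure_queries_gt_le hℓ hδ hδ1 hτ (hN i)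
        (hG i) (fun f hf => risk_le_of_optimal hD hG hopt i hf) disCoeff_nonneg hK1
        (fun V hV _ d hd hVd => meanProb_le_of_excess (hstar := glue c G) hℓ (hPB i) (hG i)
          (heq i) (hK i) hK1 hV hd hVd))
      simp only [F, Set.mem_ofPred_eq] at hω ⊢
      refine lt_of_le_of_lt ?_ hω
      rw [hrisk]
      have := (le_labelBound (ℓ := ℓ) (H := H) (hstar := glue c G) (τ := τ) (δ := δ) hD
        (i := i) (by linarith [hlg i])).trans (hsup i)
      linarith
  refine (measure_mono fun ω hω => ?_).trans
    (measure_card_le_sum_indicator_le hk (by omega : 0 < τ) hF hμF)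
  classical
  simp only [Set.mem_compl_iff, Set.mem_ofPred_eq, not_le] at hω ⊢
  have h1 : ∀ i, ((learner ℓ δ τ (H i) (z i) τ ω).queries : ℝ) ≤
      (8 * M - 1) + (F i).indicator (fun _ => (τ : ℝ)) ω := by
    intro i
    by_cases hi : ω ∈ F i
    · rw [Set.indicator_of_mem hi]
      have : ((learner ℓ δ τ (H i) (z i) τ ω).queries : ℝ) ≤ τ := by
        exact_mod_cast learner_queries_le ℓ δ τ (H i) (z i) τ ω
      linarith
    · rw [Set.indicator_of_notMem hi, add_zero]
      exact not_lt.1 hi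
  have h2 := Finset.sum_le_sum fun i (_ : i ∈ Finset.univ) => h1 i
  rw [Finset.sum_add_distrib, Finset.sum_const, Finset.card_univ, Fintype.card_fin,
    nsmul_eq_mul] at h2
  push_cast at hω
  -- The `k` labels saved by the `- 1` in each cluster must have been used up by bad clusters, with
  -- at most `τ` labels each.
  have h3 : (k : ℝ) ≤ ∑ i, (F i).indicator (fun _ => (τ : ℝ)) ω := by linarith
  have h4 := ENNReal.ofReal_le_ofReal h3
  rw [ENNReal.ofReal_natCast, ENNReal.ofReal_sum_of_nonneg
    fun i _ => Set.indicator_nonneg (fun _ _ => hτ0.le) _] at h4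
  refine h4.trans (Finset.sum_le_sum fun i _ => ?_)
  by_cases hi : ω ∈ F i
  · rw [Set.indicator_of_mem hi, Set.indicator_of_mem hi, ENNReal.ofReal_natCast]
  · rw [Set.indicator_of_notMem hi, ENNReal.ofReal_zero]; exact zero_le

end Main

end LowResource

theorem theorem2 :
    ∃ C : ℝ → ℝ → ℝ,
    ∀ {X Y Z Ω : Type*} [Fintype X] [MeasurableSpace X] [MeasurableSingletonClass X]
      [Fintype Y] [MeasurableSpace Y] [MeasurableSingletonClass Y] [MeasurableSpace Ω]
      -- the loss, with values in `[0,1]`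
      (ℓ : Z → Y → ℝ) (_ : ∀ z y, 0 ≤ ℓ z y ∧ ℓ z y ≤ 1)
      -- the law of a labelled sample of the data set `X`, and the clusters
      (D : Measure (X × Y)) [IsProbabilityMeasure D]
      (k : ℕ) (c : X → Fin k) (_ : ∀ i, D {a | c a.1 = i} ≠ 0)
      -- the finite classes of the clusters, and an optimal hypothesis
      (H : Fin k → Finset (X → Z)) (_ : ∀ i, (H i).Nonempty)
      (hstar : X → Z) (_ : hstar ∈ LowResource.hypClass c H)
      (_ : ∀ h ∈ LowResource.hypClass c H,
        LowResource.risk ℓ D hstar ≤ LowResource.risk ℓ D h)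
      -- the numbers of rounds, in total and in each cluster, and the confidence parameter
      (T τ : ℕ) (_ : T = k * τ) (_ : 2 ≤ τ) (δ : ℝ) (_ : 0 < δ)
      -- in each cluster, independent labelled samples of that cluster with uniform coins
      (μ : Measure Ω) [IsProbabilityMeasure μ] (z : Fin k → ℕ → Ω → (X × Y) × ℝ)
      (_ : ∀ i t, HasLaw (z i t)
        ((LowResource.clusterLaw D c i).prod (volume.restrict (Set.Icc (0 : ℝ) 1))) μ)
      (_ : ∀ i, iIndepFun (z i) μ),
    -- the state of the learner of cluster `i` after its `τ` rounds
    let final : Fin k → Ω → LowResource.IWALState X Z := fun i ω =>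
      LowResource.iwal ℓ δ τ (H i) (fun t => z i t ω) τ
    let N : Fin k → ℕ := LowResource.clusterSize c
    let P : Fin k → Measure (X × Y) := LowResource.clusterLaw D c
    let θ : Fin k → ℝ := fun i => LowResource.disCoeff ℓ (P i) (H i) hstar
    let K : Fin k → ℝ≥0∞ := fun i => LowResource.slopeAsym ℓ (H i) {x | c x = i}
    let Rstar : Fin k → X → ℝ := fun i x => LowResource.sampleRisk ℓ (P i) hstar x
    let p : Fin k → X → ℝ := fun i x => LowResource.sampleProb (P i) x
    let lg : Fin k → ℝ := fun i => Real.log (τ * (H i).card * N i / δ)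
    (1 - δ ≤ μ.real {ω | ∀ g : Fin k → X → Z, (∀ i, g i ∈ (final i ω).outputs) →
        LowResource.risk ℓ D (LowResource.glue c g) - LowResource.risk ℓ D hstar ≤
          k * ⨆ i, 2 / τ *
            (√((final i ω).sumProb) + 6 * √(Real.log (2 * (3 + τ) * τ ^ 2 / δ))) *
            √(Real.log (16 * τ ^ 2 * (H i).card ^ 2 * Real.log τ / δ))}) ∧
    ((∀ i, K i ≠ ∞) →
      1 - 2 * δ ≤ μ.real {ω | ((∑ i, (final i ω).queries : ℕ) : ℝ) ≤
          8 * k * ⨆ i, (K i).toReal *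
            (∑ x with c x = i, θ i * Rstar i x * τ * p i x
              + ∑ x with c x = i, C (θ i) (K i).toReal * √(Rstar i x * τ * p i x * lg i)
              + C (θ i) (K i).toReal * (N i * lg i ^ 3))}) := by
  refine ⟨LowResource.labelConst, ?_⟩
  intro X Y Z Ω _ _ _ _ _ _ _ ℓ hℓ D _ k c hD H hH hstar hhstar hopt T τ _ hτ δ hδ μ _ z hlaw hi
    final N P θ K Rstar p lg
  obtain ⟨G, hG, rfl⟩ := hhstar
  -- `HasLaw` gives almost everywhere measurability only; passing to measurable versions changes the
  -- learner on a null set.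
  choose z' hz' hzz using fun i => LowResource.exists_isSampling (hlaw i) (hi i)
  have hfinal : ∀ᵐ ω ∂μ, ∀ i, final i ω = LowResource.learner ℓ δ τ (H i) (z' i) τ ω := by
    filter_upwards [ae_all_iff.2 hzz] with ω hω i
    simp only [final, LowResource.learner, hω]
  refine ⟨LowResource.one_sub_le_measureReal hδ.le ?_, fun hK =>
    LowResource.one_sub_le_measureReal (by linarith) ?_⟩
  · refine le_trans (measure_mono_ae ?_)
      (LowResource.excess_risk_bound hℓ hD hG hopt hτ hδ hz')
    filter_upwards [hfinal] with ω hω hbad hgood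
    refine hbad fun g hg => ?_
    have := hgood g fun i => by rw [← hω i]; exact hg i
    simp only [← hω] at this
    exact this
  · refine le_trans (measure_mono_ae ?_)
      (LowResource.label_complexity_bound hℓ hD hG hopt hτ hδ hz' hK)
    filter_upwards [hfinal] with ω hω hbad hgood
    refine hbad ?_
    have h1 : ((∑ i, (LowResource.learner ℓ δ τ (H i) (z' i) τ ω).queries : ℕ) : ℝ) ≤
      8 * k * ⨆ i, LowResource.labelBound ℓ D c H (LowResource.glue c G) τ δ i := hgood
    simp only [← hω] at h1
    exact h1
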